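/- Let $n,k\ge 1$ be integers and $m=kn-1$. Write the homogeneous coordinates of $\mathbb P_m\mathbb C$ as $[z_0,\dots,z_m]=[Z_0,\dots,Z_{k-1}]$ with blocks $Z_h=(z_{hn},\dots,z_{(h+1)n-1})\in\mathbb C^n$. Let $g$ be $a_m=m+1$ times the Fubini-Study metric, that is, in each affine chart $\{z_i\neq 0\}$ (normalized by $z_i=1$), $$g_{\lambda\bar\mu}=(m+1)\,\frac{\partial^2}{\partial z_\lambda\partial\bar z_\mu}\ln\Big(1+\sum_{j\ne i}|z_j|^2\Big),$$ and let $dv$ be its volume element. A function $\varphi\in C^\infty(\mathbb P_m\mathbb C)$ (real-valued) is called $g$-admissible if the matrix $\big(g_{\lambda\bar\mu}+\frac{\partial^2\varphi}{\partial z_\lambda\partial\bar z_\mu}\big)$ is positive definite everywhere. Let $G_{n,k}$ be the group of automorphisms of $\mathbb P_m\mathbb C$ generated by the exchanges of two blocks $Z_i,Z_j$, by the rotations $z_l\mapsto e^{i\theta}z_l$ of a single homogeneous coordinate ($\theta\in\mathbb R$), and by the exchanges of two coordinates $z_p,z_q$ belonging to the same block. Let $\mathcal A_{n,k}$ be the set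 of $g$-admissible, $G_{n,k}$-invariant functions $\varphi\in C^\infty(\mathbb P_m\mathbb C)$ with $\sup\varphi=0$. (1) For every real $\alpha<1$ there is a constant $C$ (depending only on $\alpha,n,k$) such that $e^{-\alpha\varphi}$ is integrable and $$\int_{\mathbb P_m\mathbb C}e^{-\alpha\varphi}\,dv\le C\qquad\text{for all }\varphi\in\mathcal A_{n,k}.$$ (2) This is optimal when $m\ge 1$: for no $\alpha\ge 1$ does such a constant exist, and the Tian invariant of the class, $$\sup\Big\{\alpha>0:\ \exists\, C\ \ \forall\varphi\in\mathcal A_{n,k}\ \ \int_{\mathbb P_m\mathbb C}e^{-\alpha\varphi}\,dv\le C\Big\},$$ equals $1$. -/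

import Mathlib

open scoped ContDiff LinearAlgebra.Projectivization ComplexOrder

noncomputable section

namespace ProjKahler

section ProjectiveSpace

variable {ι : Type} [Fintype ι] [DecidableEq ι]

/-- Complex projective space with homogeneous coordinates `[z_j]`, `j ∈ ι`. -/
abbrev ProjSpace (ι : Type) : Type := ℙ ℂ (ι → ℂ)

/-- The quotient topology. -/
instance : TopologicalSpace (ProjSpace ι) :=
  inferInstanceAs (TopologicalSpace (Quotient (projectivizationSetoid ℂ (ι → ℂ))))

instance : MeasurableSpace (ProjSpace ι) := borel _

instance : BorelSpace (ProjSpace ι) := ⟨rfl⟩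

/-- Index set of the affine coordinates in the chart `{z_i ≠ 0}`. -/
abbrev AffIdx (i : ι) : Type := {j : ι // j ≠ i}

/-- The vector with `i`-th coordinate `1` and the other coordinates given by `w`. -/
def affVec (i : ι) (w : AffIdx i → ℂ) : ι → ℂ :=
  fun j => if h : j = i then 1 else w ⟨j, h⟩

theorem affVec_ne_zero {ι : Type} [DecidableEq ι] (i : ι) (w : AffIdx i → ℂ) :
    affVec i w ≠ 0 := fun h => by
  have := congrFun h i
  simp [affVec] at this

/-- The inverse of the usual affine chart on `{z_i ≠ 0}`. -/
def affPoint (i : ι) (w : AffIdx i → ℂ) : ProjSpace ι :=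
  Projectivization.mk ℂ (affVec i w) (affVec_ne_zero i w)

/-- `C^∞` real functions on projective space: smooth in each of the usual affine charts. -/
def IsSmooth (φ : ProjSpace ι → ℝ) : Prop :=
  ∀ i : ι, ContDiff ℝ ∞ (fun w : AffIdx i → ℂ => φ (affPoint i w))

end ProjectiveSpace

section ComplexHessian

variable {J : Type} [Fintype J] [DecidableEq J]

/-- `∂f/∂z_l = (∂f/∂x_l - i ∂f/∂y_l) / 2`. -/
def dz (l : J) (f : (J → ℂ) → ℂ) (w : J → ℂ) : ℂ :=
  (fderiv ℝ f w (Pi.single l 1) - Complex.I * fderiv ℝ f w (Pi.single l Complex.I)) / 2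

/-- `∂f/∂z̄_l = (∂f/∂x_l + i ∂f/∂y_l) / 2`. -/
def dzbar (l : J) (f : (J → ℂ) → ℂ) (w : J → ℂ) : ℂ :=
  (fderiv ℝ f w (Pi.single l 1) + Complex.I * fderiv ℝ f w (Pi.single l Complex.I)) / 2

/-- The complex Hessian `(∂²f/∂z_l∂z̄_r)` of a real function `f` on `ℂ^J`. -/
def complexHessian (f : (J → ℂ) → ℝ) (w : J → ℂ) : Matrix J J ℂ :=
  Matrix.of fun l r => dz l (dzbar r (fun v => (f v : ℂ))) w

/-- Components, in affine coordinates, of `a` times the Fubini-Study metric: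
`g_{l r̄} = a ∂²/∂z_l∂z̄_r log (1 + ∑ |z_j|²)`. -/
def fubiniStudy (a : ℝ) (w : J → ℂ) : Matrix J J ℂ :=
  (a : ℂ) • complexHessian (fun v : J → ℂ => Real.log (1 + ∑ j, ‖v j‖ ^ 2)) w

end ComplexHessian

section Metric

variable {ι : Type} [Fintype ι] [DecidableEq ι]

/-- `φ` is `C^∞` and `g_{l r̄} + ∂²φ/∂z_l∂z̄_r` is positive definite everywhere, for `g` equal
to `a` times the Fubini-Study metric. -/
structure IsAdmissible (a : ℝ) (φ : ProjSpace ι → ℝ) : Prop where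
  smooth : IsSmooth φ
  pos : ∀ (i : ι) (w : AffIdx i → ℂ),
    (fubiniStudy a w + complexHessian (fun v => φ (affPoint i v)) w).PosDef

/-- The volume element of `a` times the Fubini-Study metric, written in the dense chart
`{z_i ≠ 0}` (whose complement, a hyperplane, is negligible): it is
`det (g_{l r̄}) ∏_j (√-1 dz_j ∧ dz̄_j) = 2^m det (g_{l r̄}) ∏_j dx_j dy_j`. -/
def volumeElement (a : ℝ) (i : ι) : MeasureTheory.Measure (ProjSpace ι) :=
  MeasureTheory.Measure.map (affPoint i)
    ((MeasureTheory.volume : MeasureTheory.Measure (AffIdx i → ℂ)).withDensity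
      fun w => ENNReal.ofReal (2 ^ Fintype.card (AffIdx i) * (fubiniStudy a w).det.re))

end Metric

section Group

variable {ι : Type} [DecidableEq ι]

/-- The automorphism `[z] ↦ [z ∘ e]` permuting the homogeneous coordinates. -/
def permAut (e : Equiv.Perm ι) : Equiv.Perm (ProjSpace ι) :=
  MulAction.toPerm (LinearEquiv.funCongrLeft ℂ ℂ e)

/-- The automorphism multiplying the homogeneous coordinate `z_l` by `e^{iθ}`. -/
def rotAut (l : ι) (θ : ℝ) : Equiv.Perm (ProjSpace ι) :=
  MulAction.toPerm (LinearEquiv.piCongrRight fun j : ι =>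
    if j = l then
      LinearEquiv.smulOfNeZero ℂ ℂ (Complex.exp (θ * Complex.I)) (Complex.exp_ne_zero _)
    else LinearEquiv.refl ℂ ℂ)

end Group

/-- Homogeneous coordinates on `ℙ_m ℂ`, `m = k n - 1`, grouped in `k` blocks of length `n`:
the index `(h, p)` stands for `h n + p`. -/
abbrev Idx (n k : ℕ) : Type := Fin k × Fin n

/-- The group `G_{n,k}` generated by the exchanges of two blocks, the rotations of one homogeneous
coordinate, and the exchanges of two coordinates in the same block. -/
def G (n k : ℕ) : Subgroup (Equiv.Perm (ProjSpace (Idx n k))) :=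
  Subgroup.closure
    ({s | ∃ i j : Fin k, s = permAut ((Equiv.swap i j).prodCongr (Equiv.refl (Fin n)))} ∪
     {s | ∃ (l : Idx n k) (θ : ℝ), s = rotAut l θ} ∪
     {s | ∃ (h : Fin k) (p q : Fin n), s = permAut (Equiv.swap (h, p) (h, q))})

/-- The value `a_m = m + 1 = k n`, for which `g` lies in the first Chern class. -/
def aChern (n k : ℕ) : ℝ := ((k * n : ℕ) : ℝ)

/-- The class of `C^∞` functions that are `g`-admissible (with `a_m = m + 1`), invariant
under `G_{n,k}`, and of supremum `0`. -/
structure IsNormalized {n k : ℕ} (φ : ProjSpace (Idx n k) → ℝ) : Prop where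
  admissible : IsAdmissible (aChern n k) φ
  invariant : ∀ s ∈ G n k, ∀ x, φ (s x) = φ x
  sup_eq : IsLUB (Set.range φ) 0

/-- The volume element `dv` of `g` (`a_m = m + 1`), written in the chart `{z_0 ≠ 0}`. -/
def dv (n k : ℕ) [NeZero n] [NeZero k] : MeasureTheory.Measure (ProjSpace (Idx n k)) :=
  volumeElement (aChern n k) ((0, 0) : Idx n k)

/-- There is a constant `C` with `∫ exp (-α φ) dv ≤ C` for all `φ` in the class. -/
def HasUniformBound (n k : ℕ) [NeZero n] [NeZero k] (α : ℝ) : Prop :=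
  ∃ C : ℝ, ∀ φ : ProjSpace (Idx n k) → ℝ, IsNormalized φ →
    MeasureTheory.Integrable (fun x => Real.exp (-α * φ x)) (dv n k) ∧
      ∫ x, Real.exp (-α * φ x) ∂(dv n k) ≤ C

/-- Tian's invariant of the class: the supremum of the exponents `α > 0` for which the
uniform bound holds. -/
def tianInvariant (n k : ℕ) [NeZero n] [NeZero k] : EReal :=
  sSup ((fun α : ℝ => (α : EReal)) '' {α : ℝ | 0 < α ∧ HasUniformBound n k α})

end ProjKahler

end

/-! Write `N = m + 1` and let `Φ(x) = φ(e^x) + N log ∑ e^{2 x_j}` be the Kähler potential in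
logarithmic coordinates (`logPotential`). A function that is invariant under rotations of the
coordinates and has nonnegative Levi form is convex in the logarithms of the moduli
(`convexOn_comp_exp`), so `Φ` is convex. It also satisfies `Φ(x + c(1,…,1)) = Φ(x) + 2Nc`.

Two consequences of convexity give a lower bound on `φ` that does not depend on `φ`. Jensen's
inequality over a transitive group of coordinate permutations gives `Φ(x) ≥ Φ(0) + 2 ∑ x_j`
(`logPotential_ge`). Since `φ ≤ 0` controls the growth of `Φ` along rays from the origin, `φ ≤ Φ(0)`
on the torus and then, by density, everywhere (`homFun_exp_le`, `le_of_forall_exp_le`); hence `sup φ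
= 0` forces `Φ(0) ≥ 0`. Together, `φ ≥ 2 ∑ log |z_j| - N log |z|²` (`homFun_ge`). In a chart this
bounds `e^{-αφ} dv`, for `0 ≤ α < 1`, by a constant times `∏ |w_j|^{-2α} (1 + |w|²)^{-(1-α)N}`,
which is dominated by a product of integrable functions of one variable
(`exists_integral_exp_bound`).

For optimality, the lower bound itself is approached, up to a constant, by the smooth admissible
functions `∑ log((|z_j|²/|z|² + ε)/(1/N + ε))` (`barrier`). For `α ≥ 1` their exponential integrals
dominate a multiple of the integral of `(|w_l|² + ε)^{-1}` over the unit disc, which blows up as `ε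
→ 0` because `|w|^{-2}` is not integrable at the origin of `ℂ`. -/

noncomputable section

namespace ProjKahler

/-! ### Complex Hessian and Levi form through real second derivatives. -/

section HessianCalculus

variable {J : Type} [Fintype J] [DecidableEq J]

theorem fderiv_ofReal_comp {E : Type*} [NormedAddCommGroup E] [NormedSpace ℝ E] {f : E → ℝ}
    {w : E} (hf : DifferentiableAt ℝ f w) (u : E) :
    fderiv ℝ (fun v => (f v : ℂ)) w u = (fderiv ℝ f w u : ℂ) := by
  have h : HasFDerivAt (fun v => (f v : ℂ)) (Complex.ofRealCLM.comp (fderiv ℝ f w)) w :=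
    Complex.ofRealCLM.hasFDerivAt.comp w hf.hasFDerivAt
  rw [h.fderiv]
  rfl

theorem fderiv_fderiv_apply_eq {E : Type*} [NormedAddCommGroup E] [NormedSpace ℝ E] {f : E → ℝ}
    (hf : ContDiff ℝ 2 f) (w u v : E) :
    fderiv ℝ (fun x => fderiv ℝ f x v) w u = fderiv ℝ (fderiv ℝ f) w u v := by
  have h1 : DifferentiableAt ℝ (fderiv ℝ f) w :=
    (hf.fderiv_right (m := 1) (by norm_num)).differentiable (by norm_num) w
  rw [fderiv_clm_apply h1 (by fun_prop)]
  simp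

/-- The complex Hessian of a `C²` function in terms of its second real differential. -/
theorem complexHessian_apply {f : (J → ℂ) → ℝ} (hf : ContDiff ℝ 2 f) (w : J → ℂ) (l r : J) :
    complexHessian f w l r =
      (((fderiv ℝ (fderiv ℝ f) w (Pi.single l 1) (Pi.single r 1) +
          fderiv ℝ (fderiv ℝ f) w (Pi.single l Complex.I) (Pi.single r Complex.I) : ℝ) : ℂ) +
        Complex.I *
          ((fderiv ℝ (fderiv ℝ f) w (Pi.single l 1) (Pi.single r Complex.I) -
            fderiv ℝ (fderiv ℝ f) w (Pi.single l Complex.I) (Pi.single r 1) : ℝ) : ℂ)) / 4 := by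
  have hd : Differentiable ℝ f := hf.differentiable (by norm_num)
  have h1 : Differentiable ℝ (fderiv ℝ f) :=
    (hf.fderiv_right (m := 1) (by norm_num)).differentiable (by norm_num)
  have h2 : ∀ v, Differentiable ℝ (fun x => fderiv ℝ f x v) := fun v => by fun_prop
  have e : dzbar r (fun v => (f v : ℂ)) = fun v =>
      ((fderiv ℝ f v (Pi.single r 1) : ℝ) : ℂ) * (1 / 2) +
        ((fderiv ℝ f v (Pi.single r Complex.I) : ℝ) : ℂ) * (Complex.I / 2) := by
    funext v
    simp only [dzbar, fderiv_ofReal_comp (hd v)]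
    ring
  have hc : ∀ v, Differentiable ℝ (fun x => ((fderiv ℝ f x v : ℝ) : ℂ)) := fun v =>
    Complex.ofRealCLM.differentiable.comp (h2 v)
  have hD : ∀ u, fderiv ℝ (dzbar r (fun v => (f v : ℂ))) w u =
      ((fderiv ℝ (fderiv ℝ f) w u (Pi.single r 1) : ℝ) : ℂ) * (1 / 2) +
        ((fderiv ℝ (fderiv ℝ f) w u (Pi.single r Complex.I) : ℝ) : ℂ) * (Complex.I / 2) := by
    intro u
    rw [e, fderiv_fun_add ((hc _ w).mul_const _) ((hc _ w).mul_const _),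
      fderiv_mul_const (hc _ w), fderiv_mul_const (hc _ w)]
    simp only [add_apply, smul_apply, smul_eq_mul]
    rw [fderiv_ofReal_comp (h2 _ w), fderiv_ofReal_comp (h2 _ w), fderiv_fderiv_apply_eq hf,
      fderiv_fderiv_apply_eq hf]
    ring
  simp only [complexHessian, Matrix.of_apply, dz, hD]
  push_cast
  linear_combination (-(fderiv ℝ (fderiv ℝ f) w (Pi.single l Complex.I)
    (Pi.single r Complex.I) : ℂ) / 4) * Complex.I_sq

theorem differentiable_fderiv_of_contDiff {E : Type*} [NormedAddCommGroup E] [NormedSpace ℝ E]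
    {f : E → ℝ} (hf : ContDiff ℝ 2 f) : Differentiable ℝ (fderiv ℝ f) :=
  (hf.fderiv_right (m := 1) (by norm_num)).differentiable (by norm_num)

theorem complexHessian_add {f g : (J → ℂ) → ℝ} (hf : ContDiff ℝ 2 f) (hg : ContDiff ℝ 2 g)
    (w : J → ℂ) :
    complexHessian (fun v => f v + g v) w = complexHessian f w + complexHessian g w := by
  have e : fderiv ℝ (fun v => f v + g v) = fun v => fderiv ℝ f v + fderiv ℝ g v := by
    funext v
    exact fderiv_fun_add (hf.differentiable (by norm_num) v) (hg.differentiable (by norm_num) v)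
  ext l r
  rw [Matrix.add_apply, complexHessian_apply (hf.add hg), complexHessian_apply hf,
    complexHessian_apply hg, e, fderiv_fun_add (differentiable_fderiv_of_contDiff hf w)
      (differentiable_fderiv_of_contDiff hg w)]
  simp only [add_apply]
  push_cast
  ring

theorem complexHessian_const_mul {f : (J → ℂ) → ℝ} (hf : ContDiff ℝ 2 f) (a : ℝ) (w : J → ℂ) :
    complexHessian (fun v => a * f v) w = (a : ℂ) • complexHessian f w := by
  have e : fderiv ℝ (fun v => a * f v) = fun v => a • fderiv ℝ f v := by
    funext v
    exact fderiv_const_mul (hf.differentiable (by norm_num) v) a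
  ext l r
  rw [Matrix.smul_apply, complexHessian_apply (contDiff_const.mul hf), complexHessian_apply hf, e,
    fderiv_fun_const_smul (differentiable_fderiv_of_contDiff hf w)]
  simp only [smul_apply, smul_eq_mul]
  push_cast
  ring

theorem complexHessian_const (a : ℝ) (w : J → ℂ) :
    complexHessian (fun _ : J → ℂ => a) w = 0 := by
  ext l r
  have e : fderiv ℝ (fun _ : J → ℂ => a) = fun _ => 0 := by
    funext v
    exact fderiv_const_apply a
  rw [complexHessian_apply contDiff_const, e, fderiv_const_apply]
  simp

theorem complexHessian_sum {κ : Type*} (s : Finset κ) {f : κ → (J → ℂ) → ℝ}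
    (hf : ∀ j, ContDiff ℝ 2 (f j)) (w : J → ℂ) :
    complexHessian (fun v => ∑ j ∈ s, f j v) w = ∑ j ∈ s, complexHessian (f j) w := by
  classical
  induction s using Finset.induction_on with
  | empty => simpa using complexHessian_const 0 w
  | insert a s ha ih =>
    simp only [Finset.sum_insert ha]
    rw [complexHessian_add (hf a) (ContDiff.sum fun j _ => hf j), ih]

theorem pi_eq_sum_re_im (ξ : J → ℂ) :
    ξ = ∑ l, ((ξ l).re • (Pi.single l 1 : J → ℂ) + (ξ l).im • (Pi.single l Complex.I : J → ℂ)) := by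
  ext j
  simp only [Finset.sum_apply, Pi.add_apply, Pi.smul_apply, Pi.single_apply]
  rw [Finset.sum_eq_single j (fun b _ hb => by simp [hb.symm]) (by simp)]
  simp

/-- The Levi form in terms of the second real differential. -/
theorem levi_form_re {f : (J → ℂ) → ℝ} (hf : ContDiff ℝ 2 f) (w ξ : J → ℂ) :
    (star (star ξ) ⬝ᵥ (complexHessian f w).mulVec (star ξ)).re =
      (fderiv ℝ (fderiv ℝ f) w ξ ξ +
        fderiv ℝ (fderiv ℝ f) w (Complex.I • ξ) (Complex.I • ξ)) / 4 := by
  -- The row index of the Hessian is the holomorphic one, so the Levi form at `ξ` is the Hermitian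
  -- form of the matrix at `star ξ`.
  set D := fderiv ℝ (fderiv ℝ f) w with hD
  have e2 : Complex.I • ξ = ∑ l, ((-(ξ l).im) • (Pi.single l 1 : J → ℂ) +
      (ξ l).re • (Pi.single l Complex.I : J → ℂ)) := by
    conv_lhs => rw [pi_eq_sum_re_im (Complex.I • ξ)]
    simp
  have key : ∀ a b : J → ℝ,
      D (∑ l, (a l • (Pi.single l 1 : J → ℂ) + b l • (Pi.single l Complex.I : J → ℂ)))
        (∑ l, (a l • (Pi.single l 1 : J → ℂ) + b l • (Pi.single l Complex.I : J → ℂ))) =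
      ∑ l, ∑ r, (a l * a r * D (Pi.single l 1) (Pi.single r 1) +
        a l * b r * D (Pi.single l 1) (Pi.single r Complex.I) +
        b l * a r * D (Pi.single l Complex.I) (Pi.single r 1) +
        b l * b r * D (Pi.single l Complex.I) (Pi.single r Complex.I)) := by
    intro a b
    simp only [map_sum, map_add, map_smul, sum_apply,
      add_apply, smul_apply, smul_eq_mul]
    rw [Finset.sum_comm]
    refine Finset.sum_congr rfl fun l _ => ?_
    rw [Finset.mul_sum, Finset.mul_sum, ← Finset.sum_add_distrib]
    refine Finset.sum_congr rfl fun r _ => ?_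
    ring
  have h1 := key (fun l => (ξ l).re) (fun l => (ξ l).im)
  have h2 := key (fun l => -(ξ l).im) (fun l => (ξ l).re)
  beta_reduce at h1 h2
  rw [← pi_eq_sum_re_im ξ] at h1
  rw [← e2] at h2
  rw [h1, h2, ← Finset.sum_add_distrib, Finset.sum_div]
  simp only [dotProduct, Matrix.mulVec, star_star, Complex.re_sum, Finset.mul_sum]
  refine Finset.sum_congr rfl fun l _ => ?_
  rw [← Finset.sum_add_distrib, Finset.sum_div]
  refine Finset.sum_congr rfl fun r _ => ?_
  rw [complexHessian_apply hf, ← hD]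
  simp [Complex.mul_re, Complex.mul_im]
  ring

end HessianCalculus

/-! ### Potentials `log (b + ∑ c_j |w_j|²)` and the Fubini-Study determinant. -/

section LogQuadratic

variable {J : Type} [Fintype J]

/-- The function `b + ∑ c_j |w_j|²`. -/
def diagQuad (b : ℝ) (c : J → ℝ) (w : J → ℂ) : ℝ := b + ∑ j, c j * ‖w j‖ ^ 2

theorem diagQuad_pos {b : ℝ} {c : J → ℝ} (hb : 0 < b) (hc : ∀ j, 0 ≤ c j) (w : J → ℂ) :
    0 < diagQuad b c w :=
  add_pos_of_pos_of_nonneg hb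
    (Finset.sum_nonneg fun j _ => mul_nonneg (hc j) (sq_nonneg _))

theorem contDiff_diagQuad (b : ℝ) (c : J → ℝ) {n : WithTop ℕ∞} : ContDiff ℝ n (diagQuad b c) := by
  unfold diagQuad
  refine contDiff_const.add (ContDiff.sum fun j _ => contDiff_const.mul ?_)
  exact (contDiff_apply ℝ ℂ j).norm_sq ℝ

theorem contDiff_log_diagQuad {b : ℝ} {c : J → ℝ} (hb : 0 < b) (hc : ∀ j, 0 ≤ c j)
    {n : WithTop ℕ∞} : ContDiff ℝ n (fun w => Real.log (diagQuad b c w)) :=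
  (contDiff_diagQuad b c).log fun w => (diagQuad_pos hb hc w).ne'

theorem fderiv_diagQuad (b : ℝ) (c : J → ℝ) (w u : J → ℂ) :
    fderiv ℝ (diagQuad b c) w u = ∑ j, c j * (2 * ((w j).re * (u j).re + (w j).im * (u j).im)) := by
  have h : ∀ j, HasFDerivAt (fun v : J → ℂ => ‖v j‖ ^ 2)
      (2 • (innerSL ℝ (w j)).comp (ContinuousLinearMap.proj (R := ℝ) (φ := fun _ : J => ℂ) j)) w :=
    fun j => (ContinuousLinearMap.proj (R := ℝ) (φ := fun _ : J => ℂ) j).hasFDerivAt.norm_sq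
  have h2 : HasFDerivAt (diagQuad b c) _ w :=
    (HasFDerivAt.fun_sum fun j (_ : j ∈ Finset.univ) => (h j).const_mul (c j)).const_add b
  rw [h2.fderiv]
  simp only [sum_apply, smul_apply, ContinuousLinearMap.comp_apply,
    ContinuousLinearMap.proj_apply, innerSL_apply_apply, Complex.inner, smul_eq_mul, nsmul_eq_mul]
  refine Finset.sum_congr rfl fun j _ => ?_
  simp [mul_comm]

variable [DecidableEq J]

theorem dzbar_log_diagQuad {b : ℝ} {c : J → ℝ} (hb : 0 < b) (hc : ∀ j, 0 ≤ c j) (r : J)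
    (w : J → ℂ) :
    dzbar r (fun v => ((Real.log (diagQuad b c v) : ℝ) : ℂ)) w =
      c r * w r / (diagQuad b c w : ℂ) := by
  have hd := (contDiff_diagQuad b c (n := 1)).differentiable (by norm_num) w
  have h1 : ∀ u, fderiv ℝ (fun v => ((Real.log (diagQuad b c v) : ℝ) : ℂ)) w u =
      (((diagQuad b c w)⁻¹ * ∑ j, c j * (2 * ((w j).re * (u j).re + (w j).im * (u j).im)) : ℝ) :
        ℂ) := by
    intro u
    rw [fderiv_ofReal_comp (hd.log (diagQuad_pos hb hc w).ne'),
      fderiv.log hd (diagQuad_pos hb hc w).ne']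
    simp [fderiv_diagQuad]
  have hs : ∀ z : ℂ, ∑ j, c j * (2 * ((w j).re * ((Pi.single r z : J → ℂ) j).re +
      (w j).im * ((Pi.single r z : J → ℂ) j).im)) =
      c r * (2 * ((w r).re * z.re + (w r).im * z.im)) := by
    intro z
    rw [Finset.sum_eq_single r (fun b _ hb => by simp [hb]) (by simp)]
    simp
  simp only [dzbar, h1, hs]
  simp only [Complex.one_re, Complex.one_im, Complex.I_re, Complex.I_im]
  push_cast
  linear_combination (c r / (diagQuad b c w : ℂ)) * Complex.re_add_im (w r)

/-- The complex Hessian of `log (b + ∑ c_j |w_j|²)`. -/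
theorem complexHessian_log_diagQuad {b : ℝ} {c : J → ℝ} (hb : 0 < b) (hc : ∀ j, 0 ≤ c j)
    (w : J → ℂ) (l r : J) :
    complexHessian (fun v => Real.log (diagQuad b c v)) w l r =
      (if l = r then (c r : ℂ) else 0) / (diagQuad b c w : ℂ) -
        (c l * (starRingEnd ℂ) (w l)) * (c r * w r) / (diagQuad b c w : ℂ) ^ 2 := by
  have hq : (diagQuad b c w : ℂ) ≠ 0 := by exact_mod_cast (diagQuad_pos hb hc w).ne'
  have hd := (contDiff_diagQuad b c (n := 1)).differentiable (by norm_num) w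
  have hfun : dzbar r (fun v => ((Real.log (diagQuad b c v) : ℝ) : ℂ)) =
      fun v => (c r * v r) * ((diagQuad b c v : ℂ))⁻¹ := by
    funext v
    rw [dzbar_log_diagQuad hb hc, div_eq_mul_inv]
  have hn : HasFDerivAt (fun v : J → ℂ => (c r : ℂ) * v r)
      ((c r : ℂ) • ContinuousLinearMap.proj (R := ℝ) (φ := fun _ : J => ℂ) r) w :=
    (ContinuousLinearMap.proj (R := ℝ) (φ := fun _ : J => ℂ) r).hasFDerivAt.const_mul _
  have hQ : HasFDerivAt (fun v => (diagQuad b c v : ℂ))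
      (Complex.ofRealCLM.comp (fderiv ℝ (diagQuad b c) w)) w :=
    Complex.ofRealCLM.hasFDerivAt.comp w hd.hasFDerivAt
  have hinv : HasFDerivAt (fun v => ((diagQuad b c v : ℂ))⁻¹)
      ((-((diagQuad b c w : ℂ) ^ 2)⁻¹) • (Complex.ofRealCLM.comp (fderiv ℝ (diagQuad b c) w))) w :=
    (hasDerivAt_inv hq).comp_hasFDerivAt_of_eq w hQ rfl
  have hm := hn.mul hinv
  have h1 : ∀ u, fderiv ℝ (dzbar r (fun v => ((Real.log (diagQuad b c v) : ℝ) : ℂ))) w u =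
      c r * u r / (diagQuad b c w : ℂ) - (c r * w r) / (diagQuad b c w : ℂ) ^ 2 *
      ((∑ j, c j * (2 * ((w j).re * (u j).re + (w j).im * (u j).im)) : ℝ) : ℂ) := by
    intro u
    rw [hfun]
    erw [hm.fderiv]
    simp only [add_apply, smul_apply, smul_eq_mul,
      ContinuousLinearMap.comp_apply, ContinuousLinearMap.proj_apply, Complex.ofRealCLM_apply,
      fderiv_diagQuad]
    ring
  have hs : ∀ z : ℂ, ∑ j, c j * (2 * ((w j).re * ((Pi.single l z : J → ℂ) j).re +
      (w j).im * ((Pi.single l z : J → ℂ) j).im)) =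
      c l * (2 * ((w l).re * z.re + (w l).im * z.im)) := by
    intro z
    rw [Finset.sum_eq_single l (fun b _ hb => by simp [hb]) (by simp)]
    simp
  simp only [complexHessian, Matrix.of_apply, dz, h1, hs]
  have e : (starRingEnd ℂ) (w l) = (w l).re - (w l).im * Complex.I := by
    conv_lhs => rw [← Complex.re_add_im (w l)]
    simp [-Complex.re_add_im]
    ring
  rw [e]
  by_cases h : l = r
  · subst h
    simp only [Pi.single_eq_same, if_true]
    push_cast
    simp only [Complex.one_re, Complex.one_im, Complex.I_re, Complex.I_im, Complex.ofReal_zero,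
      Complex.ofReal_one]
    linear_combination (-(c l : ℂ) / (diagQuad b c w : ℂ) / 2) * Complex.I_sq
  · simp [h, Ne.symm h]
    ring

/-- Cauchy-Schwarz with weights `c_j` bounds the rank-one negative term; the inequality is strict
because `b > 0` is missing from the Cauchy-Schwarz bound. -/
theorem posDef_complexHessian_log_diagQuad {b : ℝ} {c : J → ℝ} (hb : 0 < b) (hc : ∀ j, 0 < c j)
    (w : J → ℂ) : (complexHessian (fun v => Real.log (diagQuad b c v)) w).PosDef := by
  have hc' : ∀ j, 0 ≤ c j := fun j => (hc j).le
  have hq := diagQuad_pos hb hc' w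
  rw [Matrix.posDef_iff_dotProduct_mulVec]
  have hH : (complexHessian (fun v => Real.log (diagQuad b c v)) w).IsHermitian := by
    ext l r
    rw [Matrix.conjTranspose_apply, complexHessian_log_diagQuad hb hc',
      complexHessian_log_diagQuad hb hc']
    by_cases h : l = r
    · subst h; simp; ring
    · simp [h, Ne.symm h]; ring
  refine ⟨hH, fun x hx => ?_⟩
  set T : ℂ := ∑ l, (c l : ℂ) * w l * x l with hT
  have e : star x ⬝ᵥ (complexHessian (fun v => Real.log (diagQuad b c v)) w).mulVec x =
      (((∑ l, c l * ‖x l‖ ^ 2) / diagQuad b c w - ‖T‖ ^ 2 / diagQuad b c w ^ 2 : ℝ) : ℂ) := by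
    have e1 : ∀ l r, star (x l) * (complexHessian (fun v => Real.log (diagQuad b c v)) w l r * x r)
        = (if l = r then (c l * ‖x l‖ ^ 2 : ℂ) / (diagQuad b c w : ℂ) else 0) -
          ((starRingEnd ℂ) (c l * w l * x l)) * (c r * w r * x r) / (diagQuad b c w : ℂ) ^ 2 := by
      intro l r
      rw [complexHessian_log_diagQuad hb hc']
      by_cases h : l = r
      · subst h
        have := Complex.conj_mul' (x l)
        simp only [if_true, ← this, map_mul, Complex.conj_ofReal]
        simp only [starRingEnd_apply]
        ring
      · simp [h]; ring
    have e2 : (‖T‖ ^ 2 : ℂ) = (starRingEnd ℂ) T * T := (Complex.conj_mul' T).symm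
    simp only [dotProduct, Matrix.mulVec, Finset.mul_sum, Pi.star_apply, e1,
      Finset.sum_sub_distrib]
    push_cast
    rw [e2, hT, map_sum, Finset.sum_mul_sum]
    simp only [Finset.sum_div, Finset.sum_ite_eq, Finset.mem_univ, if_true]
  rw [e, Complex.zero_lt_real]
  have hX : 0 < ∑ l, c l * ‖x l‖ ^ 2 := by
    obtain ⟨j, hj⟩ := Function.ne_iff.1 hx
    refine Finset.sum_pos' (fun l _ => mul_nonneg (hc' l) (sq_nonneg _)) ⟨j, Finset.mem_univ _, ?_⟩
    exact mul_pos (hc j) (pow_pos (norm_pos_iff.2 hj) 2)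
  have hCS : ‖T‖ ^ 2 ≤ (∑ l, c l * ‖w l‖ ^ 2) * ∑ l, c l * ‖x l‖ ^ 2 := by
    have h1 : ‖T‖ ≤ ∑ l, (Real.sqrt (c l) * ‖w l‖) * (Real.sqrt (c l) * ‖x l‖) := by
      refine (norm_sum_le _ _).trans (le_of_eq (Finset.sum_congr rfl fun l _ => ?_))
      rw [norm_mul, norm_mul, Complex.norm_real, Real.norm_of_nonneg (hc' l)]
      nth_rw 1 [← Real.mul_self_sqrt (hc' l)]
      ring
    have h2 := Finset.sum_mul_sq_le_sq_mul_sq Finset.univ (fun l => Real.sqrt (c l) * ‖w l‖)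
      (fun l => Real.sqrt (c l) * ‖x l‖)
    simp only [mul_pow, Real.sq_sqrt (hc' _)] at h2
    exact (pow_le_pow_left₀ (norm_nonneg _) h1 2).trans h2
  rw [sub_pos, div_lt_div_iff₀ (by positivity) hq]
  have : diagQuad b c w = b + ∑ l, c l * ‖w l‖ ^ 2 := rfl
  have h3 : ‖T‖ ^ 2 < diagQuad b c w * ∑ l, c l * ‖x l‖ ^ 2 := by
    rw [this]; nlinarith [mul_pos hb hX]
  calc ‖T‖ ^ 2 * diagQuad b c w < (diagQuad b c w * ∑ l, c l * ‖x l‖ ^ 2) * diagQuad b c w :=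
        mul_lt_mul_of_pos_right h3 hq
    _ = _ := by ring

theorem fubiniStudy_eq (a : ℝ) (w : J → ℂ) : fubiniStudy a w =
    (a : ℂ) • complexHessian (fun v : J → ℂ => Real.log (diagQuad 1 (fun _ => 1) v)) w := by
  simp [fubiniStudy, diagQuad]

/-- The metric is `a / S` times a rank-one perturbation of the identity, whose determinant is `1 /
S`; hence the one extra power of `S`. -/
theorem det_fubiniStudy (a : ℝ) (w : J → ℂ) : (fubiniStudy a w).det =
    ((a ^ Fintype.card J / (diagQuad 1 (fun _ => 1) w) ^ (Fintype.card J + 1) : ℝ) : ℂ) := by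
  have hq := diagQuad_pos (b := 1) (c := fun _ : J => 1) one_pos (fun _ => zero_le_one) w
  set S := diagQuad 1 (fun _ : J => 1) w with hS
  have hq' : (S : ℂ) ≠ 0 := by exact_mod_cast hq.ne'
  have e : fubiniStudy a w = ((a : ℂ) / S) • (1 + Matrix.replicateCol Unit
      (fun l => -(starRingEnd ℂ) (w l) / S) * Matrix.replicateRow Unit w) := by
    rw [fubiniStudy_eq]
    ext l r
    rw [Matrix.smul_apply, complexHessian_log_diagQuad one_pos (fun _ => zero_le_one),
      Matrix.smul_apply, Matrix.add_apply, Matrix.mul_apply, Matrix.one_apply, ← hS]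
    by_cases h : l = r
    · subst h; simp; field_simp; ring
    · simp [h]; field_simp
  have e2 : (1 : ℂ) + w ⬝ᵥ (fun l => -(starRingEnd ℂ) (w l) / S) = 1 / S := by
    have h1 : w ⬝ᵥ (fun l => -(starRingEnd ℂ) (w l) / S) = -((S : ℂ) - 1) / S := by
      have : (S : ℂ) - 1 = ∑ l, w l * (starRingEnd ℂ) (w l) := by
        rw [hS]
        simp [diagQuad, Complex.mul_conj']
      rw [this, ← Finset.sum_neg_distrib, Finset.sum_div]
      exact Finset.sum_congr rfl fun l _ => by ring
    rw [h1]; field_simp; ring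
  rw [e, Matrix.det_smul, Matrix.det_one_add_replicateCol_mul_replicateRow, e2]
  push_cast
  rw [div_pow, pow_succ]
  field_simp

end LogQuadratic

/-! ### Plurisubharmonic torus-invariant functions are log-convex. -/

section LogConvexity

variable {J : Type} [Fintype J]

/-- The curve `t ↦ (p_j e^{c_j t})_j`. -/
def expCurve (p c : J → ℂ) (t : ℝ) : J → ℂ := fun j => p j * Complex.exp (c j * t)

omit [Fintype J] in
theorem hasDerivAt_expCurve (p c : J → ℂ) (t : ℝ) :
    HasDerivAt (expCurve p c) (c * expCurve p c t) t := by
  rw [hasDerivAt_pi]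
  intro j
  have h1 : HasDerivAt (fun s : ℝ => c j * (s : ℂ)) (c j) t := by
    simpa using (Complex.ofRealCLM.hasDerivAt (x := t)).const_mul (c j)
  have h2 := (h1.cexp).const_mul (p j)
  have e : (c * expCurve p c t) j = p j * (Complex.exp (c j * t) * c j) := by
    simp only [expCurve, Pi.mul_apply]
    ring
  rw [e]
  exact h2

theorem hasDerivAt_comp_expCurve {F : (J → ℂ) → ℝ} (hF : ContDiff ℝ 2 F) (p c : J → ℂ) (t : ℝ) :
    HasDerivAt (fun s => F (expCurve p c s))
      (fderiv ℝ F (expCurve p c t) (c * expCurve p c t)) t :=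
  ((hF.differentiable (by norm_num) _).hasFDerivAt).comp_hasDerivAt t (hasDerivAt_expCurve p c t)

theorem hasDerivAt_fderiv_expCurve {F : (J → ℂ) → ℝ} (hF : ContDiff ℝ 2 F) (p c : J → ℂ)
    (t : ℝ) :
    HasDerivAt (fun s => fderiv ℝ F (expCurve p c s) (c * expCurve p c s))
      (fderiv ℝ (fderiv ℝ F) (expCurve p c t) (c * expCurve p c t) (c * expCurve p c t) +
        fderiv ℝ F (expCurve p c t) (c * (c * expCurve p c t))) t := by
  have h1 := ((differentiable_fderiv_of_contDiff hF (expCurve p c t)).hasFDerivAt).comp_hasDerivAt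
    t (hasDerivAt_expCurve p c t)
  have h2 : HasDerivAt (fun s => c * expCurve p c s) (c * (c * expCurve p c t)) t :=
    (hasDerivAt_expCurve p c t).const_mul c
  exact h1.clm_apply h2

/-- A `C²` function on `ℂ^J` that is invariant under rotations of the coordinates and has a
nonnegative Levi form is convex in the logarithms of the moduli of the coordinates. -/
theorem convexOn_comp_exp [DecidableEq J] {F : (J → ℂ) → ℝ} (hF : ContDiff ℝ 2 F)
    (hpos : ∀ w ξ : J → ℂ, 0 ≤ (star ξ ⬝ᵥ (complexHessian F w).mulVec ξ).re)
    (hrot : ∀ (θ : J → ℝ) (w : J → ℂ), F (fun j => Complex.exp (θ j * Complex.I) * w j) = F w) :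
    ConvexOn ℝ Set.univ (fun x : J → ℝ => F (fun j => Complex.exp (x j))) := by
  -- Convexity is tested on real lines; in the coordinates `e^{x_j}` a line is an `expCurve` with
  -- real exponents `v`.
  have line : ∀ x v : J → ℝ, ConvexOn ℝ Set.univ
      (fun t : ℝ => F (fun j => Complex.exp ((x j + t * v j : ℝ) : ℂ))) := by
    intro x v
    set p : J → ℂ := fun j => Complex.exp (x j) with hp
    set c : J → ℂ := fun j => v j with hc
    have e : (fun t : ℝ => F (fun j => Complex.exp ((x j + t * v j : ℝ) : ℂ))) =
        fun t => F (expCurve p c t) := by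
      funext t
      congr 1
      funext j
      rw [expCurve, hp, hc, ← Complex.exp_add]
      push_cast
      ring_nf
    rw [e]
    have d1 : deriv (fun t => F (expCurve p c t)) =
        fun t => fderiv ℝ F (expCurve p c t) (c * expCurve p c t) :=
      funext fun t => (hasDerivAt_comp_expCurve hF p c t).deriv
    refine convexOn_univ_of_deriv2_nonneg
      (fun t => (hasDerivAt_comp_expCurve hF p c t).differentiableAt) ?_ fun t => ?_
    · rw [d1]
      exact fun t => (hasDerivAt_fderiv_expCurve hF p c t).differentiableAt
    rw [Function.iterate_succ, Function.iterate_one, Function.comp_apply, d1,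
      (hasDerivAt_fderiv_expCurve hF p c t).deriv]
    set q := expCurve p c t with hq
    -- The curve with exponents `i v` stays in a torus orbit, so `F` is constant along it. Its zero
    -- second derivative gives `D²F(icq, icq) = DF(c²q)`, which turns the second derivative along
    -- the real curve into `D²F(cq, cq) + D²F(icq, icq)`, four times the Levi form.
    set c' : J → ℂ := Complex.I • c with hc'
    have hconst : (fun s => F (expCurve q c' s)) = fun _ => F q := by
      funext s
      rw [← hrot (fun j => v j * s) q]
      congr 1
      funext j
      simp only [expCurve, hc', hc, Pi.smul_apply, smul_eq_mul]
      push_cast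
      ring_nf
    have d0 : (fun s => fderiv ℝ F (expCurve q c' s) (c' * expCurve q c' s)) = fun _ => 0 := by
      funext s
      rw [← (hasDerivAt_comp_expCurve hF q c' s).deriv, hconst, deriv_const]
    have d2 := (hasDerivAt_fderiv_expCurve hF q c' 0).deriv
    rw [d0, deriv_const] at d2
    have q0 : expCurve q c' 0 = q := by
      funext j
      simp [expCurve]
    have e1 : c' * q = Complex.I • (c * q) := by
      rw [hc', smul_mul_assoc]
    have e2 : c' * (c' * q) = -(c * (c * q)) := by
      funext j
      simp only [hc', Pi.mul_apply, Pi.smul_apply, Pi.neg_apply, smul_eq_mul]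
      linear_combination (c j * (c j * q j)) * Complex.I_sq
    rw [q0, e2, e1, map_neg] at d2
    have h := levi_form_re hF q (c * q)
    have h' := hpos q (star (c * q))
    rw [h] at h'
    linarith
  refine ⟨convex_univ, fun x _ y _ a b ha hb hab => ?_⟩
  have h := (line x (y - x)).2 (Set.mem_univ 0) (Set.mem_univ 1) ha hb hab
  have ha' : a = 1 - b := by linarith
  subst ha'
  convert h using 3 with j
  · simp
    ring
  · simp
  · simp

end LogConvexity

/-! ### Functions on projective space as homogeneous functions of degree `0`. -/

section HomogeneousFunctions

variable {ι : Type}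

open Classical in
/-- The homogeneous function of degree `0` on `ℂ^ι` (with value `0` at the origin) defined by a
function on projective space. -/
def homFun (φ : ProjSpace ι → ℝ) (z : ι → ℂ) : ℝ :=
  if h : z ≠ 0 then φ (Projectivization.mk ℂ z h) else 0

theorem homFun_of_ne_zero (φ : ProjSpace ι → ℝ) {z : ι → ℂ} (hz : z ≠ 0) :
    homFun φ z = φ (Projectivization.mk ℂ z hz) := dif_pos hz

theorem homFun_smul (φ : ProjSpace ι → ℝ) {c : ℂ} (hc : c ≠ 0) (z : ι → ℂ) :
    homFun φ (c • z) = homFun φ z := by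
  by_cases hz : z = 0
  · simp [hz]
  · rw [homFun_of_ne_zero φ hz, homFun_of_ne_zero φ (smul_ne_zero hc hz)]
    congr 1
    rw [Projectivization.mk_eq_mk_iff']
    exact ⟨c, rfl⟩

theorem homFun_rep (φ : ProjSpace ι → ℝ) (x : ProjSpace ι) : homFun φ x.rep = φ x := by
  rw [homFun_of_ne_zero φ x.rep_nonzero, Projectivization.mk_rep]

theorem permAut_mk (e : Equiv.Perm ι) {z : ι → ℂ} (hz : z ≠ 0) (hz' : z ∘ e ≠ 0) :
    permAut e (Projectivization.mk ℂ z hz) = Projectivization.mk ℂ (z ∘ e) hz' := rfl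

theorem homFun_comp_perm {φ : ProjSpace ι → ℝ} {e : Equiv.Perm ι}
    (h : ∀ x, φ (permAut e x) = φ x) (z : ι → ℂ) : homFun φ (z ∘ e) = homFun φ z := by
  by_cases hz : z = 0
  · subst hz; rfl
  · have hz' : z ∘ e ≠ 0 := fun h0 => hz <| by
      funext j
      simpa using congrFun h0 (e.symm j)
    rw [homFun_of_ne_zero φ hz, homFun_of_ne_zero φ hz', ← permAut_mk e hz, h]

variable [DecidableEq ι]

theorem homFun_affVec (φ : ProjSpace ι → ℝ) (i : ι) (w : AffIdx i → ℂ) :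
    homFun φ (affVec i w) = φ (affPoint i w) := homFun_of_ne_zero φ _

theorem affVec_div (i : ι) {z : ι → ℂ} (hz : z i ≠ 0) :
    affVec i (fun j : AffIdx i => z j / z i) = (z i)⁻¹ • z := by
  funext j
  by_cases h : j = i
  · subst h; simp [affVec, hz]
  · simp [affVec, h, div_eq_inv_mul]

theorem homFun_eq_affPoint (φ : ProjSpace ι → ℝ) (i : ι) {z : ι → ℂ} (hz : z i ≠ 0) :
    homFun φ z = φ (affPoint i fun j : AffIdx i => z j / z i) := by
  rw [← homFun_affVec φ, affVec_div i hz, homFun_smul φ (inv_ne_zero hz)]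

theorem rotAut_mk (l : ι) (θ : ℝ) {z : ι → ℂ} (hz : z ≠ 0)
    (hz' : (fun j => (if j = l then Complex.exp (θ * Complex.I) else 1) * z j) ≠ 0) :
    rotAut l θ (Projectivization.mk ℂ z hz) = Projectivization.mk ℂ _ hz' := by
  have : (LinearEquiv.piCongrRight fun j : ι =>
    if j = l then
      LinearEquiv.smulOfNeZero ℂ ℂ (Complex.exp (θ * Complex.I)) (Complex.exp_ne_zero _)
    else LinearEquiv.refl ℂ ℂ) z =
      (fun j => (if j = l then Complex.exp (θ * Complex.I) else 1) * z j) := by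
    funext j
    by_cases h : j = l
    · simp [h]
    · simp [h]
  simp only [← this]
  rfl

theorem homFun_rot {φ : ProjSpace ι → ℝ} (h : ∀ l θ x, φ (rotAut l θ x) = φ x) (l : ι) (θ : ℝ)
    (z : ι → ℂ) :
    homFun φ (fun j => (if j = l then Complex.exp (θ * Complex.I) else 1) * z j) = homFun φ z := by
  by_cases hz : z = 0
  · subst hz
    congr 1
    funext j
    simp
  · have hz' : (fun j => (if j = l then Complex.exp (θ * Complex.I) else 1) * z j) ≠ 0 :=
      fun h0 => hz <| by
        funext j
        have := congrFun h0 j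
        by_cases hj : j = l
        · simpa [hj] using this
        · simpa [hj] using this
    rw [homFun_of_ne_zero φ hz, homFun_of_ne_zero φ hz', ← rotAut_mk l θ hz, h]

variable [Fintype ι]

theorem homFun_torus {φ : ProjSpace ι → ℝ} (h : ∀ l θ x, φ (rotAut l θ x) = φ x) (θ : ι → ℝ)
    (z : ι → ℂ) : homFun φ (fun j => Complex.exp (θ j * Complex.I) * z j) = homFun φ z := by
  have key : ∀ s : Finset ι,
      homFun φ (fun j => (if j ∈ s then Complex.exp (θ j * Complex.I) else 1) * z j) =
        homFun φ z := by
    intro s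
    induction s using Finset.induction_on with
    | empty => simp
    | insert a s ha ih =>
      rw [← ih, ← homFun_rot h a (θ a)
        (fun j => (if j ∈ s then Complex.exp (θ j * Complex.I) else 1) * z j)]
      congr 1
      funext j
      by_cases hj : j = a
      · subst hj; simp [ha]
      · simp [hj]
  simpa using key Finset.univ

theorem homFun_norm {φ : ProjSpace ι → ℝ} (h : ∀ l θ x, φ (rotAut l θ x) = φ x) (z : ι → ℂ) :
    homFun φ (fun j => (‖z j‖ : ℂ)) = homFun φ z := by
  rw [← homFun_torus h (fun j => Complex.arg (z j)) (fun j => (‖z j‖ : ℂ))]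
  congr 1
  funext j
  rw [mul_comm, Complex.norm_mul_exp_arg_mul_I]

end HomogeneousFunctions

/-! ### The uniform lower bound on invariant admissible functions. -/

section LowerBound

variable {ι : Type} [Fintype ι] [DecidableEq ι]

theorem sum_norm_affVec_sq (i : ι) (w : AffIdx i → ℂ) :
    ∑ j, ‖affVec i w j‖ ^ 2 = diagQuad 1 (fun _ => 1) w := by
  rw [Fintype.sum_eq_add_sum_subtype_ne _ i]
  unfold diagQuad
  congr 1
  · simp [affVec]
  · refine Finset.sum_congr rfl fun j _ => ?_
    simp [affVec, j.2]

/-- The local potential of `g + i∂∂̄φ` in an affine chart. -/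
def chartPotential (a : ℝ) (φ : ProjSpace ι → ℝ) (i : ι) (w : AffIdx i → ℂ) : ℝ :=
  a * Real.log (diagQuad 1 (fun _ => 1) w) + φ (affPoint i w)

theorem contDiff_mul_log_diagQuad {J : Type} [Fintype J] (a : ℝ) {n : WithTop ℕ∞} :
    ContDiff ℝ n (fun w : J → ℂ => a * Real.log (diagQuad 1 (fun _ => 1) w)) :=
  contDiff_const.mul (contDiff_log_diagQuad one_pos fun _ => zero_le_one)

theorem contDiff_chartPotential (a : ℝ) {φ : ProjSpace ι → ℝ} (hφ : IsSmooth φ) (i : ι) :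
    ContDiff ℝ 2 (chartPotential a φ i) :=
  (contDiff_mul_log_diagQuad a).add (contDiff_infty.1 (hφ i) 2)

theorem complexHessian_chartPotential (a : ℝ) {φ : ProjSpace ι → ℝ} (hφ : IsSmooth φ) (i : ι)
    (w : AffIdx i → ℂ) : complexHessian (chartPotential a φ i) w =
      fubiniStudy a w + complexHessian (fun v => φ (affPoint i v)) w := by
  rw [fubiniStudy_eq, ← complexHessian_const_mul
      (contDiff_log_diagQuad one_pos fun _ => zero_le_one),
    ← complexHessian_add (contDiff_mul_log_diagQuad a)
      (contDiff_infty.1 (hφ i) 2)]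
  rfl

omit [Fintype ι] in
theorem affVec_torus (i : ι) (θ : AffIdx i → ℝ) (w : AffIdx i → ℂ) :
    affVec i (fun j => Complex.exp (θ j * Complex.I) * w j) =
      fun j => Complex.exp ((if h : j = i then 0 else θ ⟨j, h⟩ : ℝ) * Complex.I) *
        affVec i w j := by
  funext j
  by_cases h : j = i
  · simp [affVec, h]
  · simp [affVec, h]

theorem convexOn_chartPotential_exp {a : ℝ} {φ : ProjSpace ι → ℝ} (hφ : IsAdmissible a φ)
    (hrot : ∀ l θ x, φ (rotAut l θ x) = φ x) (i : ι) :
    ConvexOn ℝ Set.univ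
      (fun x : AffIdx i → ℝ => chartPotential a φ i fun j => Complex.exp (x j)) := by
  refine convexOn_comp_exp (contDiff_chartPotential a hφ.smooth i) (fun w ξ => ?_) fun θ w => ?_
  · rw [complexHessian_chartPotential a hφ.smooth]
    by_cases hξ : ξ = 0
    · simp [hξ]
    · exact (Complex.lt_def.1
        ((Matrix.posDef_iff_dotProduct_mulVec.1 (hφ.pos i w)).2 hξ)).1.le
  · unfold chartPotential
    congr 1
    · congr 2
      simp [diagQuad, Complex.norm_exp]
    · rw [← homFun_affVec φ, ← homFun_affVec φ, affVec_torus, homFun_torus hrot]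

/-- The potential of `g + i∂∂̄φ` on the open torus, in logarithmic coordinates. -/
def logPotential (a : ℝ) (φ : ProjSpace ι → ℝ) (x : ι → ℝ) : ℝ :=
  homFun φ (fun j => Complex.exp (x j)) + a * Real.log (∑ j, Real.exp (x j) ^ 2)

/-- Dividing by the `i`-th coordinate leaves the degree-`0` part unchanged and costs the logarithm
only a linear term, so convexity passes from the chart to all of `ι → ℝ`. -/
theorem logPotential_eq_chartPotential (a : ℝ) (φ : ProjSpace ι → ℝ) (i : ι) (x : ι → ℝ) :
    logPotential a φ x = chartPotential a φ i (fun j => Complex.exp ((x j - x i : ℝ) : ℂ)) +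
      2 * a * x i := by
  have e : (fun j => Complex.exp (x j)) =
      Complex.exp (x i) • affVec i (fun j => Complex.exp ((x j - x i : ℝ) : ℂ)) := by
    funext j
    by_cases h : j = i
    · subst h; simp [affVec]
    · simp [affVec, h, ← Complex.exp_add]
  have e2 : ∑ j, Real.exp (x j) ^ 2 = Real.exp (x i) ^ 2 *
      diagQuad 1 (fun _ => 1) (fun j : AffIdx i => Complex.exp ((x j - x i : ℝ) : ℂ)) := by
    rw [← sum_norm_affVec_sq, Finset.mul_sum]
    refine Finset.sum_congr rfl fun j _ => ?_
    have := congrArg norm (congrFun e j)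
    rw [Complex.norm_exp, Pi.smul_apply, norm_smul, Complex.norm_exp] at this
    simp only [Complex.ofReal_re] at this
    rw [this, mul_pow]
  unfold logPotential chartPotential
  rw [e, homFun_smul φ (Complex.exp_ne_zero _), homFun_affVec, e2,
    Real.log_mul (by positivity) (diagQuad_pos one_pos (fun _ => zero_le_one) _).ne',
    Real.log_pow, Real.log_exp]
  push_cast
  ring

theorem convexOn_logPotential [Nonempty ι] {a : ℝ} {φ : ProjSpace ι → ℝ} (hφ : IsAdmissible a φ)
    (hrot : ∀ l θ x, φ (rotAut l θ x) = φ x) : ConvexOn ℝ Set.univ (logPotential a φ) := by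
  obtain ⟨i⟩ := ‹Nonempty ι›
  let L : (ι → ℝ) →ₗ[ℝ] (AffIdx i → ℝ) :=
    LinearMap.pi fun j => (LinearMap.proj (j : ι) : (ι → ℝ) →ₗ[ℝ] ℝ) - LinearMap.proj i
  have h1 := (convexOn_chartPotential_exp hφ hrot i).comp_linearMap L
  have h2 : ConvexOn ℝ Set.univ (fun x : ι → ℝ => 2 * a * x i) :=
    ((2 * a) • (LinearMap.proj i : (ι → ℝ) →ₗ[ℝ] ℝ)).convexOn convex_univ
  have h3 := h1.add h2
  have e : logPotential a φ = ((fun x : AffIdx i → ℝ =>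
      chartPotential a φ i fun j => Complex.exp (x j)) ∘ L) + fun x => 2 * a * x i := by
    funext x
    rw [logPotential_eq_chartPotential a φ i]
    rfl
  rw [e]
  exact h3

omit [DecidableEq ι] in
theorem logPotential_const [Nonempty ι] (a : ℝ) (φ : ProjSpace ι → ℝ) (c : ℝ) :
    logPotential a φ (fun _ => c) = logPotential a φ 0 + 2 * a * c := by
  have hN : (0 : ℝ) < Fintype.card ι := by exact_mod_cast Fintype.card_pos
  have e : (fun _ : ι => Complex.exp c) =
      Complex.exp c • fun _ : ι => Complex.exp ((0 : ℝ) : ℂ) := by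
    funext j
    simp
  unfold logPotential
  rw [e, homFun_smul φ (Complex.exp_ne_zero _)]
  simp only [Pi.zero_apply, Real.exp_zero, one_pow, Finset.sum_const, nsmul_eq_mul, mul_one,
    Finset.card_univ]
  rw [Real.log_mul hN.ne' (by positivity), Real.log_pow, Real.log_exp]
  push_cast
  ring

-- By transitivity the orbit average has equal entries, and it preserves the sum of the entries.
omit [DecidableEq ι] in
theorem average_perm_eq_const [Nonempty ι] (H : Subgroup (Equiv.Perm ι)) [Fintype H]
    (htrans : ∀ i j, ∃ e ∈ H, e i = j) (x : ι → ℝ) :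
    ∑ e : H, (1 / (Fintype.card H : ℝ)) • (x ∘ (e : Equiv.Perm ι)) =
      fun _ => (∑ j, x j) / Fintype.card ι := by
  have hN : (Fintype.card ι : ℝ) ≠ 0 := by exact_mod_cast Fintype.card_ne_zero
  have hH : (Fintype.card H : ℝ) ≠ 0 := by exact_mod_cast Fintype.card_ne_zero
  have h1 : ∀ i j, ∑ e : H, x ((e : Equiv.Perm ι) i) = ∑ e : H, x ((e : Equiv.Perm ι) j) := by
    intro i j
    obtain ⟨τ, hτ, hij⟩ := htrans i j
    rw [← hij, ← Equiv.sum_comp (Equiv.mulRight (⟨τ, hτ⟩ : H))]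
    rfl
  have h2 : ∑ j, ∑ e : H, x ((e : Equiv.Perm ι) j) = Fintype.card H * ∑ j, x j := by
    rw [Finset.sum_comm]
    simp only [fun e : H => Equiv.sum_comp (e : Equiv.Perm ι) x]
    simp
  funext i
  rw [Finset.sum_congr rfl fun j _ => h1 j i] at h2
  simp only [Finset.sum_const, nsmul_eq_mul, Finset.card_univ] at h2
  rw [Finset.sum_apply]
  simp only [Pi.smul_apply, Function.comp_apply, smul_eq_mul]
  rw [← Finset.mul_sum]
  field_simp
  linarith

/-- Jensen's inequality over the orbit of `x` under `H`: the potential takes the same value on the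
whole orbit, and the orbit average is a constant vector. -/
theorem logPotential_ge [Nonempty ι] {a : ℝ} {φ : ProjSpace ι → ℝ} (hφ : IsAdmissible a φ)
    (hrot : ∀ l θ x, φ (rotAut l θ x) = φ x) (H : Subgroup (Equiv.Perm ι))
    (hH : ∀ e ∈ H, ∀ x, φ (permAut e x) = φ x) (htrans : ∀ i j, ∃ e ∈ H, e i = j) (x : ι → ℝ) :
    logPotential a φ 0 + 2 * a * ((∑ j, x j) / Fintype.card ι) ≤ logPotential a φ x := by
  classical
  have hc : (Fintype.card H : ℝ) ≠ 0 := by exact_mod_cast Fintype.card_ne_zero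
  have h := (convexOn_logPotential hφ hrot).map_sum_le (t := (Finset.univ : Finset H))
    (w := fun _ => 1 / (Fintype.card H : ℝ)) (p := fun e => x ∘ (e : Equiv.Perm ι))
    (fun _ _ => by positivity) (by simp [hc]) (fun _ _ => Set.mem_univ _)
  rw [average_perm_eq_const H htrans, logPotential_const] at h
  have e : ∀ e : H, logPotential a φ (x ∘ (e : Equiv.Perm ι)) = logPotential a φ x := by
    intro e
    unfold logPotential
    congr 1
    · exact homFun_comp_perm (hH e e.2) (fun j => Complex.exp (x j))
    · congr 2
      exact Equiv.sum_comp (e : Equiv.Perm ι) fun j => Real.exp (x j) ^ 2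
  simp only [e, Finset.sum_const, Finset.card_univ, nsmul_eq_mul, smul_eq_mul] at h
  field_simp at h ⊢
  linarith

/-- The condition `φ ≤ 0` limits the slope of the potential at infinity along the ray through `x` to
`2a max x_j`. By convexity the potential is then at most its value at `0` plus `2a max x_j`, and `2
max x_j ≤ log ∑ e^{2 x_j}`. -/
theorem homFun_exp_le [Nonempty ι] {a : ℝ} (ha : 0 ≤ a) {φ : ProjSpace ι → ℝ}
    (hφ : IsAdmissible a φ) (hrot : ∀ l θ x, φ (rotAut l θ x) = φ x) (hle : ∀ x, φ x ≤ 0)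
    (x : ι → ℝ) : homFun φ (fun j => Complex.exp (x j)) ≤ logPotential a φ 0 := by
  have hN : (0 : ℝ) < Fintype.card ι := by exact_mod_cast Fintype.card_pos
  obtain ⟨i, hi⟩ := Finite.exists_max x
  have hU : ∀ t : ℝ, 0 ≤ t →
      logPotential a φ (t • x) ≤ a * Real.log (Fintype.card ι) + 2 * a * (t * x i) := by
    intro t ht
    unfold logPotential
    have h1 : homFun φ (fun j => Complex.exp ((t • x) j : ℝ)) ≤ 0 := by
      rw [homFun_of_ne_zero φ (fun h0 => Complex.exp_ne_zero _ (congrFun h0 i))]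
      exact hle _
    have h2 : Real.log (∑ j, Real.exp ((t • x) j) ^ 2) ≤
        Real.log (Fintype.card ι * Real.exp (t * x i) ^ 2) := by
      refine Real.log_le_log (Finset.sum_pos (fun j _ => by positivity) Finset.univ_nonempty) ?_
      calc ∑ j, Real.exp ((t • x) j) ^ 2 ≤ ∑ _j : ι, Real.exp (t * x i) ^ 2 := by
            refine Finset.sum_le_sum fun j _ => ?_
            simp only [Pi.smul_apply, smul_eq_mul]
            gcongr
            exact hi j
        _ = _ := by simp
    rw [Real.log_mul hN.ne' (by positivity), Real.log_pow, Real.log_exp] at h2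
    push_cast at h2
    nlinarith [mul_le_mul_of_nonneg_left h2 ha]
  -- Convexity between `0` and the far point `x / s`, of which `x` is the combination with weights
  -- `1 - s` and `s`; the bounded term of the growth estimate disappears as `s → 0`.
  have hs : ∀ s ∈ Set.Ioc (0 : ℝ) 1, logPotential a φ x ≤ logPotential a φ 0 + 2 * a * x i +
      s * (a * Real.log (Fintype.card ι) - logPotential a φ 0) := by
    intro s hs
    have h := (convexOn_logPotential hφ hrot).2 (Set.mem_univ (0 : ι → ℝ))
      (Set.mem_univ (s⁻¹ • x)) (sub_nonneg.2 hs.2) hs.1.le (by ring)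
    rw [smul_zero, zero_add, smul_inv_smul₀ hs.1.ne', smul_eq_mul, smul_eq_mul] at h
    have h2 := mul_le_mul_of_nonneg_left (hU s⁻¹ (inv_nonneg.2 hs.1.le)) hs.1.le
    have h3 : s * (2 * a * (s⁻¹ * x i)) = 2 * a * x i := by
      have := hs.1.ne'
      field_simp
    linarith
  have hlim : logPotential a φ x ≤ logPotential a φ 0 + 2 * a * x i := by
    have ht : Filter.Tendsto (fun s : ℝ => logPotential a φ 0 + 2 * a * x i +
        s * (a * Real.log (Fintype.card ι) - logPotential a φ 0)) (nhdsWithin 0 (Set.Ioi 0))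
        (nhds (logPotential a φ 0 + 2 * a * x i +
          0 * (a * Real.log (Fintype.card ι) - logPotential a φ 0))) :=
      Filter.Tendsto.mono_left (Continuous.tendsto (by fun_prop) 0) nhdsWithin_le_nhds
    have h := ge_of_tendsto ht
      (Filter.eventually_of_mem (Ioc_mem_nhdsGT zero_lt_one) hs)
    simpa using h
  have hlog : 2 * x i ≤ Real.log (∑ j, Real.exp (x j) ^ 2) := by
    have h1 : 2 * x i = Real.log (Real.exp (x i) ^ 2) := by
      rw [Real.log_pow, Real.log_exp]; push_cast; ring
    rw [h1]
    exact Real.log_le_log (by positivity) (Finset.single_le_sum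
      (f := fun j => Real.exp (x j) ^ 2) (fun j _ => by positivity) (Finset.mem_univ i))
  have := mul_le_mul_of_nonneg_left hlog ha
  have e : logPotential a φ x = homFun φ (fun j => Complex.exp (x j)) +
    a * Real.log (∑ j, Real.exp (x j) ^ 2) := rfl
  linarith

theorem homFun_eq_exp_log {φ : ProjSpace ι → ℝ} (hrot : ∀ l θ x, φ (rotAut l θ x) = φ x)
    {z : ι → ℂ} (hz : ∀ j, z j ≠ 0) :
    homFun φ z = homFun φ (fun j => Complex.exp (Real.log ‖z j‖ : ℝ)) := by
  rw [← homFun_norm hrot z]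
  congr 1
  funext j
  rw [← Complex.ofReal_exp, Real.exp_log (norm_pos_iff.2 (hz j))]

theorem dense_forall_ne_zero {J : Type} : Dense {w : J → ℂ | ∀ j, w j ≠ 0} := by
  have h := dense_pi (Set.univ : Set J) (s := fun _ => ({0}ᶜ : Set ℂ))
    fun _ _ => dense_compl_singleton 0
  simpa [Set.pi, Set.ofPred_forall] using h

/-- The points with all coordinates nonzero are dense in each chart, and up to rotations they have
the form `e^x`. -/
theorem le_of_forall_exp_le {φ : ProjSpace ι → ℝ} (hφ : IsSmooth φ)
    (hrot : ∀ l θ x, φ (rotAut l θ x) = φ x) {B : ℝ}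
    (hB : ∀ x : ι → ℝ, homFun φ (fun j => Complex.exp (x j)) ≤ B) (x : ProjSpace ι) :
    φ x ≤ B := by
  obtain ⟨i, hi⟩ := Function.ne_iff.1 x.rep_nonzero
  rw [← homFun_rep φ x, homFun_eq_affPoint φ i hi]
  refine isClosed_property dense_forall_ne_zero.denseRange_val
    (p := fun w : AffIdx i → ℂ => φ (affPoint i w) ≤ B)
    (isClosed_le (hφ i).continuous continuous_const) (fun w => ?_) _
  have hw : ∀ j, affVec i (w : AffIdx i → ℂ) j ≠ 0 := by
    intro j
    by_cases h : j = i
    · simp [affVec, h]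
    · simpa [affVec, h] using w.2 ⟨j, h⟩
  rw [← homFun_affVec φ, homFun_eq_exp_log hrot hw]
  exact hB _

/-- The lower bound by the logarithm of the product of the homogeneous coordinates. -/
theorem homFun_ge [Nonempty ι] {φ : ProjSpace ι → ℝ} (hφ : IsAdmissible (Fintype.card ι) φ)
    (hrot : ∀ l θ x, φ (rotAut l θ x) = φ x) (H : Subgroup (Equiv.Perm ι))
    (hH : ∀ e ∈ H, ∀ x, φ (permAut e x) = φ x) (htrans : ∀ i j, ∃ e ∈ H, e i = j)
    (hsup : IsLUB (Set.range φ) 0) {z : ι → ℂ} (hz : ∀ j, z j ≠ 0) :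
    2 * ∑ j, Real.log ‖z j‖ - Fintype.card ι * Real.log (∑ j, ‖z j‖ ^ 2) ≤ homFun φ z := by
  have hN : (Fintype.card ι : ℝ) ≠ 0 := by exact_mod_cast Fintype.card_ne_zero
  have hle : ∀ x, φ x ≤ 0 := fun x => hsup.1 ⟨x, rfl⟩
  -- `logPotential φ 0` is an upper bound of `φ`, and `0` is the least one.
  have h0 : 0 ≤ logPotential (Fintype.card ι) φ 0 := by
    refine hsup.2 ?_
    rintro _ ⟨x, rfl⟩
    exact le_of_forall_exp_le hφ.smooth hrot
      (homFun_exp_le (Nat.cast_nonneg _) hφ hrot hle) x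
  have h1 := logPotential_ge hφ hrot H hH htrans (fun j => Real.log ‖z j‖)
  unfold logPotential at h1
  rw [← homFun_eq_exp_log hrot hz] at h1
  simp only [fun j => Real.exp_log (norm_pos_iff.2 (hz j))] at h1
  unfold logPotential at h0
  -- The normalization `a = N` turns the mean into a sum: each coordinate then enters with weight
  -- exactly `2`, which fixes the critical exponent `1`.
  have h2 : 2 * (Fintype.card ι : ℝ) * ((∑ j, Real.log ‖z j‖) / Fintype.card ι) =
      2 * ∑ j, Real.log ‖z j‖ := by field_simp
  linarith

end LowerBound

/-! ### Continuity of charts and of smooth functions. -/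

section Measurability

variable {ι : Type}

theorem isQuotientMap_mk : Topology.IsQuotientMap
    (fun v : {v : ι → ℂ // v ≠ 0} => (Projectivization.mk ℂ v.1 v.2 : ProjSpace ι)) :=
  isQuotientMap_quot_mk

variable [DecidableEq ι]

theorem continuous_affPoint (i : ι) : Continuous (affPoint i) := by
  have h : Continuous (affVec i) := by
    refine continuous_pi fun j => ?_
    by_cases h : j = i
    · simp only [affVec, h, dite_true]; exact continuous_const
    · simp only [affVec, h, dite_false]; exact continuous_apply _
  exact isQuotientMap_mk.continuous.comp (h.subtype_mk (affVec_ne_zero i))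

variable [Fintype ι]

theorem IsSmooth.continuous {φ : ProjSpace ι → ℝ} (hφ : IsSmooth φ) : Continuous φ := by
  rw [isQuotientMap_mk.continuous_iff, continuous_iff_continuousAt]
  intro v
  obtain ⟨i, hi⟩ := Function.ne_iff.1 v.2
  have hev : ∀ᶠ u : {v : ι → ℂ // v ≠ 0} in nhds v, u.1 i ≠ 0 :=
    ((continuous_apply i).comp continuous_subtype_val).continuousAt.eventually_ne hi
  have hc : ContinuousAt (fun u : {v : ι → ℂ // v ≠ 0} =>
      φ (affPoint i fun j : AffIdx i => u.1 j / u.1 i)) v := by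
    refine ContinuousAt.comp (g := fun w : AffIdx i → ℂ => φ (affPoint i w))
      (hφ i).continuous.continuousAt ?_
    refine continuousAt_pi.2 fun j => ContinuousAt.div ?_ ?_ hi
    · exact ((continuous_apply _).comp continuous_subtype_val).continuousAt
    · exact ((continuous_apply _).comp continuous_subtype_val).continuousAt
  refine hc.congr (hev.mono fun u hu => ?_)
  exact (homFun_eq_affPoint φ i hu).symm.trans (homFun_of_ne_zero φ u.2)

end Measurability

/-! ### Volume density and the exponential integral bound. -/

section Volume

open MeasureTheory

variable {ι : Type} [Fintype ι] [DecidableEq ι]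

/-- The density of the volume element in an affine chart. -/
def volDensity (a : ℝ) (i : ι) (w : AffIdx i → ℂ) : ℝ :=
  (2 * a) ^ Fintype.card (AffIdx i) /
    diagQuad 1 (fun _ => 1) w ^ (Fintype.card (AffIdx i) + 1)

theorem volDensity_nonneg {a : ℝ} (ha : 0 ≤ a) (i : ι) (w : AffIdx i → ℂ) :
    0 ≤ volDensity a i w := by
  have := diagQuad_pos (b := 1) (c := fun _ : AffIdx i => 1) one_pos (fun _ => zero_le_one) w
  unfold volDensity
  positivity

theorem continuous_volDensity (a : ℝ) (i : ι) : Continuous (volDensity a i) := by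
  unfold volDensity
  refine continuous_const.div (((contDiff_diagQuad (n := 0) _ _).continuous).pow _) fun w => ?_
  exact pow_ne_zero _ (diagQuad_pos one_pos (fun _ => zero_le_one) w).ne'

theorem volumeElement_eq (a : ℝ) (i : ι) : volumeElement a i = Measure.map (affPoint i)
    ((volume : Measure (AffIdx i → ℂ)).withDensity
      fun w => ENNReal.ofReal (volDensity a i w)) := by
  unfold volumeElement volDensity
  congr 2
  funext w
  rw [det_fubiniStudy, Complex.ofReal_re]
  congr 1
  ring

theorem integrable_volumeElement {a : ℝ} (ha : 0 ≤ a) (i : ι) {g : ProjSpace ι → ℝ}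
    (hg : Continuous g) : Integrable g (volumeElement a i) ↔
      Integrable fun w => volDensity a i w * g (affPoint i w) := by
  rw [volumeElement_eq, integrable_map_measure hg.aestronglyMeasurable
      (continuous_affPoint i).measurable.aemeasurable,
    integrable_withDensity_iff_integrable_smul'
      (continuous_volDensity a i).measurable.ennreal_ofReal
      (Filter.Eventually.of_forall fun _ => ENNReal.ofReal_lt_top)]
  simp only [ENNReal.toReal_ofReal (volDensity_nonneg ha i _), smul_eq_mul, Function.comp_apply]

theorem integral_volumeElement {a : ℝ} (ha : 0 ≤ a) (i : ι) {g : ProjSpace ι → ℝ}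
    (hg : Continuous g) :
    ∫ x, g x ∂(volumeElement a i) = ∫ w, volDensity a i w * g (affPoint i w) := by
  rw [volumeElement_eq, integral_map (continuous_affPoint i).measurable.aemeasurable
      hg.aestronglyMeasurable,
    integral_withDensity_eq_integral_toReal_smul
      (continuous_volDensity a i).measurable.ennreal_ofReal
      (Filter.Eventually.of_forall fun _ => ENNReal.ofReal_lt_top)]
  simp only [ENNReal.toReal_ofReal (volDensity_nonneg ha i _), smul_eq_mul]

theorem ae_forall_ne_zero {J : Type} [Fintype J] : ∀ᵐ w : J → ℂ, ∀ j, w j ≠ 0 :=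
  Filter.eventually_all.2 fun j => Measure.ae_eval_ne (fun _ => volume) j 0

/-- The radial function `r^{-2α} (1 + r²)^{-c}`. -/
def radialKernel (α c r : ℝ) : ℝ :=
  Real.exp (-2 * α * Real.log r - c * Real.log (1 + r ^ 2))

/-- In polar coordinates the integrand behaves like `r^{1-2α}` near `0` and `r^{1-2α-2c}` at
infinity; the two hypotheses are the convergence conditions at the two ends. -/
theorem integrable_radialKernel {α c : ℝ} (hα : α < 1) (hc : 1 - α < c) :
    Integrable fun z : ℂ => radialKernel α c ‖z‖ := by
  have hc0 : 0 < c := by linarith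
  rw [integrable_fun_norm_addHaar volume (f := radialKernel α c), Complex.finrank_real_complex]
  have hm : Measurable fun y : ℝ => y ^ (2 - 1) • radialKernel α c y := by
    unfold radialKernel
    fun_prop
  have hy : ∀ y : ℝ, 0 < y →
      ‖y ^ (2 - 1) • radialKernel α c y‖ = y * radialKernel α c y := by
    intro y hy
    have : 0 < radialKernel α c y := Real.exp_pos _
    simp [Real.norm_eq_abs, abs_of_pos hy, abs_of_pos this]
  rw [← Set.Ioc_union_Ioi_eq_Ioi (zero_le_one (α := ℝ)), integrableOn_union]
  constructor
  · have h1 : IntegrableOn (fun y : ℝ => y ^ (1 - 2 * α)) (Set.Ioc 0 1) := by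
      rw [integrableOn_Ioc_iff_integrableOn_Ioo,
        intervalIntegral.integrableOn_Ioo_rpow_iff one_pos]
      linarith
    refine Integrable.mono' h1 hm.aestronglyMeasurable ?_
    refine (ae_restrict_iff' measurableSet_Ioc).2 (Filter.Eventually.of_forall fun y hy1 => ?_)
    rw [hy y hy1.1, Real.rpow_def_of_pos hy1.1]
    nth_rw 1 [← Real.exp_log hy1.1]
    rw [radialKernel, ← Real.exp_add, Real.exp_le_exp]
    have : 0 ≤ Real.log (1 + y ^ 2) := Real.log_nonneg (by nlinarith [sq_nonneg y])
    nlinarith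
  · have h1 : IntegrableOn (fun y : ℝ => y ^ (1 - 2 * α - 2 * c)) (Set.Ioi 1) :=
      integrableOn_Ioi_rpow_of_lt (by linarith) one_pos
    refine Integrable.mono' h1 hm.aestronglyMeasurable ?_
    refine (ae_restrict_iff' measurableSet_Ioi).2 (Filter.Eventually.of_forall fun y hy1 => ?_)
    have hy0 : 0 < y := one_pos.trans hy1
    rw [hy y hy0, Real.rpow_def_of_pos hy0]
    nth_rw 1 [← Real.exp_log hy0]
    rw [radialKernel, ← Real.exp_add, Real.exp_le_exp]
    have h2 : 2 * Real.log y ≤ Real.log (1 + y ^ 2) := by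
      have : Real.log (y ^ 2) ≤ Real.log (1 + y ^ 2) :=
        Real.log_le_log (by positivity) (by linarith)
      rw [Real.log_pow] at this
      exact_mod_cast this
    nlinarith

/-- Lets a power of `1 + |w|²` be split into factors of one variable each. -/
theorem sum_log_le_card_mul_log_diagQuad {J : Type} [Fintype J] (w : J → ℂ) :
    ∑ j, Real.log (1 + ‖w j‖ ^ 2) ≤ Fintype.card J * Real.log (diagQuad 1 (fun _ => 1) w) := by
  calc ∑ j, Real.log (1 + ‖w j‖ ^ 2) ≤ ∑ _j : J, Real.log (diagQuad 1 (fun _ => 1) w) := by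
        refine Finset.sum_le_sum fun j _ => Real.log_le_log (by positivity) ?_
        have := Finset.single_le_sum (f := fun j => ‖w j‖ ^ 2) (fun j _ => by positivity)
          (Finset.mem_univ j)
        simpa [diagQuad] using this
    _ = _ := by simp

/-- Exponential integrability of functions bounded below by the logarithm of the product of the
homogeneous coordinates. -/
theorem exists_integral_exp_bound [Nonempty ι] (i : ι) {α : ℝ} (hα : α < 1) :
    ∃ C : ℝ, ∀ φ : ProjSpace ι → ℝ, Continuous φ → (∀ x, φ x ≤ 0) →
      (∀ z : ι → ℂ, (∀ j, z j ≠ 0) →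
        2 * ∑ j, Real.log ‖z j‖ - Fintype.card ι * Real.log (∑ j, ‖z j‖ ^ 2) ≤ homFun φ z) →
      Integrable (fun x => Real.exp (-α * φ x)) (volumeElement (Fintype.card ι) i) ∧
        ∫ x, Real.exp (-α * φ x) ∂(volumeElement (Fintype.card ι) i) ≤ C := by
  obtain ⟨N, hN⟩ : ∃ N : ℝ, N = Fintype.card ι := ⟨_, rfl⟩
  simp only [← hN]
  have hN1 : 1 ≤ N := by rw [hN]; exact_mod_cast Fintype.card_pos
  -- Since `φ ≤ 0`, a negative exponent is covered by the exponent `0`.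
  set β := max α 0 with hβ
  have hβ0 : 0 ≤ β := le_max_right _ _
  have hβ1 : β < 1 := max_lt hα one_pos
  have hcard : (Fintype.card (AffIdx i) : ℝ) + 1 = N := by
    have h := Fintype.card_subtype_compl (fun j => j = i)
    rw [Fintype.card_subtype_eq] at h
    have h2 : 1 ≤ Fintype.card ι := Fintype.card_pos
    have h3 : Fintype.card (AffIdx i) + 1 = Fintype.card ι := by
      change Fintype.card {j // ¬ j = i} + 1 = _
      omega
    rw [hN, ← h3]
    push_cast
    rfl
  -- The exponent must exceed `1 - β` for convergence in each variable, while `c (N - 1) ≤ (1 - β)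
  -- N` is all the decay available. The denominator `N - 1/2` meets both and is nonzero also when `N
  -- = 1`.
  set c := (1 - β) * (N / (N - 1 / 2)) with hc
  have hcβ : 1 - β < c := by
    have : 1 < N / (N - 1 / 2) := by rw [one_lt_div (by linarith)]; linarith
    nlinarith
  have hcN : c * (N - 1) ≤ (1 - β) * N := by
    rw [hc, mul_assoc]
    refine mul_le_mul_of_nonneg_left ?_ (by linarith)
    rw [div_mul_eq_mul_div, div_le_iff₀ (by linarith)]
    nlinarith
  have hint : Integrable fun w : AffIdx i → ℂ =>
      (2 * N) ^ Fintype.card (AffIdx i) * ∏ j, radialKernel β c ‖w j‖ :=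
    (Integrable.fintype_prod (μ := fun _ => volume) fun _ : AffIdx i =>
      integrable_radialKernel hβ1 hcβ).const_mul _
  refine ⟨∫ w : AffIdx i → ℂ,
    (2 * N) ^ Fintype.card (AffIdx i) * ∏ j, radialKernel β c ‖w j‖, fun φ hφ hφ0 hφz => ?_⟩
  have hN0 : 0 ≤ N := by linarith
  have hcont : Continuous fun x => Real.exp (-α * φ x) :=
    Real.continuous_exp.comp (continuous_const.mul hφ)
  rw [integrable_volumeElement hN0 i hcont, integral_volumeElement hN0 i hcont]
  have hle : ∀ᵐ w : AffIdx i → ℂ, volDensity N i w * Real.exp (-α * φ (affPoint i w)) ≤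
      (2 * N) ^ Fintype.card (AffIdx i) * ∏ j, radialKernel β c ‖w j‖ := by
    filter_upwards [ae_forall_ne_zero] with w hw
    set S := diagQuad 1 (fun _ => 1) w with hS
    have hS0 : 0 < S := diagQuad_pos one_pos (fun _ => zero_le_one) w
    have hS1 : 1 ≤ S := by
      have : 0 ≤ ∑ j, (1 : ℝ) * ‖w j‖ ^ 2 := Finset.sum_nonneg fun j _ => by positivity
      rw [hS, diagQuad]; linarith
    have hne : ∀ j, affVec i w j ≠ 0 := by
      intro j
      by_cases h : j = i
      · simp [affVec, h]
      · simpa [affVec, h] using hw ⟨j, h⟩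
    have h1 := hφz (affVec i w) hne
    have h2 : ∑ j, Real.log ‖affVec i w j‖ = ∑ j, Real.log ‖w j‖ := by
      rw [Fintype.sum_eq_add_sum_subtype_ne _ i]
      simp [affVec]
      exact Finset.sum_congr rfl fun j _ => by simp [j.2]
    rw [sum_norm_affVec_sq, ← hS, homFun_affVec, h2] at h1
    have h3 : volDensity N i w =
        (2 * N) ^ Fintype.card (AffIdx i) * Real.exp (-(N * Real.log S)) := by
      rw [volDensity, ← hS, div_eq_mul_inv, Real.exp_neg, ← hcard, mul_comm _ (Real.log S),
        ← Real.rpow_def_of_pos hS0, ← Nat.cast_add_one, Real.rpow_natCast]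
    have h4 : ∏ j, radialKernel β c ‖w j‖ =
        Real.exp (-2 * β * ∑ j, Real.log ‖w j‖ - c * ∑ j, Real.log (1 + ‖w j‖ ^ 2)) := by
      simp only [radialKernel]
      rw [← Real.exp_sum, Finset.sum_sub_distrib, Finset.mul_sum, Finset.mul_sum]
    rw [h3, h4, mul_assoc, ← Real.exp_add]
    refine mul_le_mul_of_nonneg_left (Real.exp_le_exp.2 ?_) (by positivity)
    have h5 : -α * φ (affPoint i w) ≤ -β * φ (affPoint i w) := by
      nlinarith [hφ0 (affPoint i w), le_max_left α 0]
    have h6 := mul_le_mul_of_nonneg_left h1 hβ0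
    have h7 := mul_le_mul_of_nonneg_left (sum_log_le_card_mul_log_diagQuad w)
      (show 0 ≤ c by linarith)
    have h8 := mul_le_mul_of_nonneg_right hcN (Real.log_nonneg hS1)
    have h9 : (Fintype.card (AffIdx i) : ℝ) = N - 1 := by linarith
    rw [h9, ← hS] at h7
    nlinarith
  have hnn : ∀ w : AffIdx i → ℂ, 0 ≤ volDensity N i w * Real.exp (-α * φ (affPoint i w)) :=
    fun w => mul_nonneg (volDensity_nonneg hN0 i w) (Real.exp_pos _).le
  have hI : Integrable fun w => volDensity N i w * Real.exp (-α * φ (affPoint i w)) := by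
    refine Integrable.mono' hint ?_ (hle.mono fun w hw => ?_)
    · exact ((continuous_volDensity N i).mul
        (hcont.comp (continuous_affPoint i))).aestronglyMeasurable
    · rwa [Real.norm_of_nonneg (hnn w)]
  exact ⟨hI, integral_mono_ae hI hint hle⟩

end Volume

/-! ### Transitivity of the symmetry group; the bound for `α < 1`. -/

section Symmetry

theorem permAut_mul {ι : Type} (e f : Equiv.Perm ι) :
    permAut (e * f) = permAut f * permAut e := by
  ext x
  induction x using Projectivization.ind with
  | h v hv => rfl

/-- The permutations of the coordinates leaving a function invariant. -/
def permSymmetries {ι : Type} (φ : ProjSpace ι → ℝ) : Subgroup (Equiv.Perm ι) where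
  carrier := {e | ∀ x, φ (permAut e x) = φ x}
  mul_mem' := fun {e f} he hf x => by
    rw [permAut_mul, Equiv.Perm.mul_apply, hf, he]
  one_mem' := fun x => by
    induction x using Projectivization.ind with
    | h v hv => rfl
  inv_mem' := fun {e} he x => by
    rw [← he (permAut e⁻¹ x), ← Equiv.Perm.mul_apply, ← permAut_mul]
    congr 1
    rw [inv_mul_cancel]
    induction x using Projectivization.ind with
    | h v hv => rfl

variable {n k : ℕ}

/-- Exchange the blocks first, then two coordinates inside the target block. Transitivity is all
that the lower bound takes from the block structure. -/
theorem exists_permSymmetries_apply_eq {φ : ProjSpace (Idx n k) → ℝ}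
    (hφ : ∀ s ∈ G n k, ∀ x, φ (s x) = φ x) (i j : Idx n k) :
    ∃ e ∈ permSymmetries φ, e i = j := by
  obtain ⟨h, p⟩ := i
  obtain ⟨h', q⟩ := j
  refine ⟨Equiv.swap (h', p) (h', q) * (Equiv.swap h h').prodCongr (Equiv.refl (Fin n)),
    Subgroup.mul_mem _ ?_ ?_, ?_⟩
  · exact hφ _ (Subgroup.subset_closure (Or.inr ⟨h', p, q, rfl⟩))
  · exact hφ _ (Subgroup.subset_closure (Or.inl (Or.inl ⟨h, h', rfl⟩)))
  · simp

theorem card_Idx : (Fintype.card (Idx n k) : ℝ) = aChern n k := by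
  simp [aChern]

/-- The uniform bound for exponents less than `1`. -/
theorem hasUniformBound_of_lt_one [NeZero n] [NeZero k] {α : ℝ} (hα : α < 1) :
    HasUniformBound n k α := by
  obtain ⟨C, hC⟩ := exists_integral_exp_bound ((0, 0) : Idx n k) hα
  refine ⟨C, fun φ hφ => ?_⟩
  rw [dv, ← card_Idx]
  refine hC φ hφ.admissible.smooth.continuous (fun x => hφ.sup_eq.1 ⟨x, rfl⟩) fun z hz => ?_
  refine homFun_ge (by rw [card_Idx]; exact hφ.admissible) (fun l θ x => ?_) (permSymmetries φ)
    (fun e he => he) (exists_permSymmetries_apply_eq hφ.invariant) hφ.sup_eq hz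
  exact hφ.invariant _ (Subgroup.subset_closure (Or.inl (Or.inr ⟨l, θ, rfl⟩))) x

end Symmetry

/-! ### Admissible functions with nearly extremal singularities. -/

section Barrier

variable {ι : Type} [Fintype ι]

/-- The functions `(t_j + ε) / (1/N + ε)`, where `t_j = |z_j|² / |z|²`. -/
def barrierFactor (ε : ℝ) (z : ι → ℂ) (j : ι) : ℝ :=
  (‖z j‖ ^ 2 / ∑ l, ‖z l‖ ^ 2 + ε) / (1 / Fintype.card ι + ε)

/-- The function `∑_j log ((t_j + ε) / (1/N + ε))`, where `t_j = |z_j|² / |z|²`. -/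
def barrier (ε : ℝ) (x : ProjSpace ι) : ℝ := ∑ j, Real.log (barrierFactor ε x.rep j)

theorem barrier_mk (ε : ℝ) {z : ι → ℂ} (hz : z ≠ 0) :
    barrier ε (Projectivization.mk ℂ z hz) = ∑ j, Real.log (barrierFactor ε z j) := by
  obtain ⟨a, ha⟩ := Projectivization.exists_smul_eq_mk_rep ℂ z hz
  unfold barrier
  rw [← ha]
  refine Finset.sum_congr rfl fun j _ => ?_
  have h0 : ‖(a : ℂ)‖ ^ 2 ≠ 0 := pow_ne_zero _ (norm_ne_zero_iff.2 a.ne_zero)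
  unfold barrierFactor
  simp only [Pi.smul_apply, Units.smul_def, norm_smul, mul_pow, ← Finset.mul_sum]
  rw [mul_div_mul_left _ _ h0]

theorem barrier_permAut (ε : ℝ) (e : Equiv.Perm ι) (x : ProjSpace ι) :
    barrier ε (permAut e x) = barrier ε x := by
  induction x using Projectivization.ind with
  | h z hz =>
    have hz' : z ∘ e ≠ 0 := fun h0 => hz <| by
      funext j
      simpa using congrFun h0 (e.symm j)
    rw [permAut_mk e hz hz', barrier_mk, barrier_mk,
      ← Equiv.sum_comp e fun j => Real.log (barrierFactor ε z j)]
    refine Finset.sum_congr rfl fun j _ => ?_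
    unfold barrierFactor
    rw [← Equiv.sum_comp e fun l => ‖z l‖ ^ 2]
    rfl

theorem sum_norm_sq_pos {z : ι → ℂ} (hz : z ≠ 0) : 0 < ∑ l, ‖z l‖ ^ 2 := by
  obtain ⟨i, hi⟩ := Function.ne_iff.1 hz
  exact Finset.sum_pos' (fun l _ => by positivity)
    ⟨i, Finset.mem_univ _, pow_pos (norm_pos_iff.2 hi) 2⟩

theorem barrierFactor_pos {ε : ℝ} (hε : 0 < ε) (z : ι → ℂ) (j : ι) :
    0 < barrierFactor ε z j := by
  unfold barrierFactor
  positivity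

theorem sum_barrierFactor [Nonempty ι] {ε : ℝ} (hε : 0 < ε) {z : ι → ℂ} (hz : z ≠ 0) :
    ∑ j, barrierFactor ε z j = Fintype.card ι := by
  have hN : (0 : ℝ) < Fintype.card ι := by exact_mod_cast Fintype.card_pos
  unfold barrierFactor
  rw [← Finset.sum_div, Finset.sum_add_distrib, ← Finset.sum_div, div_self (sum_norm_sq_pos hz).ne']
  simp only [Finset.sum_const, Finset.card_univ, nsmul_eq_mul]
  field_simp

/-- The factors sum to `N`, so `log t ≤ t - 1` gives the bound `0`; it is attained at `[1, …, 1]`.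
-/
theorem isLUB_range_barrier [Nonempty ι] {ε : ℝ} (hε : 0 < ε) :
    IsLUB (Set.range (barrier (ι := ι) ε)) 0 := by
  have hN : (0 : ℝ) < Fintype.card ι := by exact_mod_cast Fintype.card_pos
  refine IsGreatest.isLUB ⟨?_, ?_⟩
  · have h1 : (fun _ : ι => (1 : ℂ)) ≠ 0 := fun h => by
      simpa using congrFun h (Classical.arbitrary ι)
    refine ⟨Projectivization.mk ℂ _ h1, ?_⟩
    rw [barrier_mk]
    refine Finset.sum_eq_zero fun j _ => ?_
    have : barrierFactor ε (fun _ : ι => (1 : ℂ)) j = 1 := by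
      simp only [barrierFactor, norm_one, one_pow, Finset.sum_const, Finset.card_univ,
        nsmul_eq_mul, mul_one]
      exact div_self (by positivity)
    rw [this, Real.log_one]
  · rintro _ ⟨x, rfl⟩
    calc barrier ε x ≤ ∑ j, (barrierFactor ε x.rep j - 1) :=
          Finset.sum_le_sum fun j _ => Real.log_le_sub_one_of_pos (barrierFactor_pos hε _ j)
      _ = 0 := by
          rw [Finset.sum_sub_distrib, sum_barrierFactor hε x.rep_nonzero]
          simp

variable [DecidableEq ι]

theorem barrier_rotAut (ε : ℝ) (l : ι) (θ : ℝ) (x : ProjSpace ι) :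
    barrier ε (rotAut l θ x) = barrier ε x := by
  induction x using Projectivization.ind with
  | h z hz =>
    have hn : ∀ j, ‖(if j = l then Complex.exp (θ * Complex.I) else 1) * z j‖ = ‖z j‖ := by
      intro j
      by_cases h : j = l
      · simp [h, Complex.norm_exp_ofReal_mul_I]
      · simp [h]
    have hz' : (fun j => (if j = l then Complex.exp (θ * Complex.I) else 1) * z j) ≠ 0 :=
      fun h0 => hz <| by
        funext j
        have := congrArg norm (congrFun h0 j)
        rw [hn] at this
        simpa using this
    rw [rotAut_mk l θ hz hz', barrier_mk, barrier_mk]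
    simp only [barrierFactor, hn]

theorem barrier_affPoint {ε : ℝ} (hε : 0 < ε) (i : ι) (w : AffIdx i → ℂ) :
    barrier ε (affPoint i w) =
      ∑ j, (Real.log (diagQuad (ε + if i = j then 1 else 0)
        (fun l : AffIdx i => ε + if (l : ι) = j then 1 else 0) w) -
        Real.log (diagQuad 1 (fun _ => 1) w) - Real.log (1 / Fintype.card ι + ε)) := by
  rw [affPoint, barrier_mk]
  refine Finset.sum_congr rfl fun j _ => ?_
  have hS : 0 < diagQuad 1 (fun _ : AffIdx i => 1) w := diagQuad_pos one_pos (fun _ => zero_le_one) w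
  have e : diagQuad (ε + if i = j then 1 else 0)
      (fun l : AffIdx i => ε + if (l : ι) = j then 1 else 0) w =
      ‖affVec i w j‖ ^ 2 + ε * diagQuad 1 (fun _ => 1) w := by
    have e1 : ‖affVec i w j‖ ^ 2 = ∑ l, (if l = j then 1 else 0) * ‖affVec i w l‖ ^ 2 := by
      simp
    rw [e1, ← sum_norm_affVec_sq, Finset.mul_sum, ← Finset.sum_add_distrib,
      Fintype.sum_eq_add_sum_subtype_ne _ i, diagQuad]
    congr 1
    · simp [affVec]; ring
    · refine Finset.sum_congr rfl fun l _ => ?_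
      simp only [affVec, l.2, dite_false]
      ring
  have hn : 0 < ‖affVec i w j‖ ^ 2 + ε * diagQuad 1 (fun _ => 1) w := by positivity
  rw [e, barrierFactor, sum_norm_affVec_sq, Real.log_div (by positivity) (by positivity),
    ← Real.log_div hn.ne' hS.ne']
  congr 2
  field_simp

theorem contDiff_log_barrierQuad {ε : ℝ} (hε : 0 < ε) (i j : ι) {n : WithTop ℕ∞} :
    ContDiff ℝ n (fun w : AffIdx i → ℂ => Real.log (diagQuad (ε + if i = j then 1 else 0)
      (fun l : AffIdx i => ε + if (l : ι) = j then 1 else 0) w)) :=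
  contDiff_log_diagQuad (by split_ifs <;> linarith) fun l => by split_ifs <;> linarith

theorem isSmooth_barrier {ε : ℝ} (hε : 0 < ε) : IsSmooth (barrier (ι := ι) ε) := by
  intro i
  simp only [barrier_affPoint hε]
  exact ContDiff.sum fun j _ => ((contDiff_log_barrierQuad hε i j).sub
    (contDiff_log_diagQuad one_pos fun _ => zero_le_one)).sub contDiff_const

/-- The `N` denominators `|z|²` cancel the Fubini-Study potential `N log |z|²` exactly. Up to a
constant there remains the sum of the `log (|z_j|² + ε |z|²)`, each strictly plurisubharmonic in the
chart because `ε > 0`. -/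
theorem isAdmissible_barrier [Nonempty ι] {ε : ℝ} (hε : 0 < ε) :
    IsAdmissible (Fintype.card ι) (barrier (ι := ι) ε) := by
  refine ⟨isSmooth_barrier hε, fun i w => ?_⟩
  rw [← complexHessian_chartPotential _ (isSmooth_barrier hε)]
  have e : chartPotential (Fintype.card ι) (barrier ε) i = fun v =>
      (∑ j, Real.log (diagQuad (ε + if i = j then 1 else 0)
        (fun l : AffIdx i => ε + if (l : ι) = j then 1 else 0) v)) +
        -(Fintype.card ι * Real.log (1 / Fintype.card ι + ε)) := by
    funext v
    rw [chartPotential, barrier_affPoint hε, Finset.sum_sub_distrib, Finset.sum_sub_distrib]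
    simp only [Finset.sum_const, Finset.card_univ, nsmul_eq_mul]
    ring
  rw [e, complexHessian_add (ContDiff.sum fun j _ => contDiff_log_barrierQuad hε i j)
    contDiff_const, complexHessian_const, add_zero,
    complexHessian_sum _ fun j => contDiff_log_barrierQuad hε i j]
  refine Finset.sum_induction_nonempty _ Matrix.PosDef (fun _ _ ha hb => ha.add hb)
    Finset.univ_nonempty fun j _ => ?_
  exact posDef_complexHessian_log_diagQuad (by split_ifs <;> linarith)
    (fun l => by split_ifs <;> linarith) w

theorem isNormalized_barrier {n k : ℕ} [NeZero n] [NeZero k] {ε : ℝ} (hε : 0 < ε) :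
    IsNormalized (barrier (ι := Idx n k) ε) := by
  refine ⟨?_, fun s hs => ?_, isLUB_range_barrier hε⟩
  · rw [← card_Idx]
    exact isAdmissible_barrier hε
  · induction hs using Subgroup.closure_induction with
    | mem s hs =>
      rcases hs with (⟨i, j, rfl⟩ | ⟨l, θ, rfl⟩) | ⟨h, p, q, rfl⟩
      · exact barrier_permAut ε _
      · exact barrier_rotAut ε l θ
      · exact barrier_permAut ε _
    | one => exact fun x => rfl
    | mul s t _ _ hs ht => exact fun x => by rw [Equiv.Perm.mul_apply, hs, ht]
    | inv s _ hs => exact fun x => by rw [← hs (s⁻¹ x), ← Equiv.Perm.mul_apply,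
        mul_inv_cancel, Equiv.Perm.one_apply]

end Barrier

/-! ### Blow-up for `α ≥ 1` and the value of the invariant. -/

section Divergence

open MeasureTheory

theorem not_integrable_indicator_inv_sq :
    ¬ Integrable fun z : ℂ => (Set.Icc (0 : ℝ) 1).indicator (fun r => (r ^ 2)⁻¹) ‖z‖ := by
  rw [integrable_fun_norm_addHaar volume
    (f := (Set.Icc (0 : ℝ) 1).indicator fun r => (r ^ 2)⁻¹), Complex.finrank_real_complex]
  intro h
  have h1 : IntegrableOn (fun y : ℝ => y ^ (-1 : ℝ)) (Set.Ioo 0 1) := by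
    refine (h.mono_set Set.Ioo_subset_Ioi_self).congr_fun (fun y hy => ?_) measurableSet_Ioo
    have : y ≠ 0 := hy.1.ne'
    simp only [Set.indicator_of_mem (Set.Ioo_subset_Icc_self hy), Real.rpow_neg_one, smul_eq_mul]
    field_simp
    norm_num
  rw [intervalIntegral.integrableOn_Ioo_rpow_iff one_pos] at h1
  exact lt_irrefl _ h1

theorem integrable_indicator_closedBall {f : ℂ → ℝ} (hf : Continuous f) :
    Integrable ((Metric.closedBall (0 : ℂ) 1).indicator f) :=
  (integrable_indicator_iff Metric.isClosed_closedBall.measurableSet).2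
    (hf.continuousOn.integrableOn_compact (isCompact_closedBall 0 1))

theorem continuous_inv_norm_sq_add {ε : ℝ} (hε : 0 < ε) :
    Continuous fun z : ℂ => (‖z‖ ^ 2 + ε)⁻¹ :=
  Continuous.inv₀ (by fun_prop) fun z => by positivity

/-- The integrals of `(|z|² + ε)⁻¹` on the unit disc are not bounded as `ε → 0`. -/
theorem not_bounded_integral_inv_norm_sq_add (C : ℝ) :
    ¬ ∀ ε : ℝ, 0 < ε → ε ≤ 1 →
      ∫ z : ℂ, (Metric.closedBall (0 : ℂ) 1).indicator (fun z => (‖z‖ ^ 2 + ε)⁻¹) z ≤ C := by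
  intro h
  refine not_integrable_indicator_inv_sq ?_
  -- Fatou's lemma along `ε = 1 / (p + 1)`: bounded integrals would make the limit `|z|^{-2}`
  -- integrable on the disc.
  set e : ℕ → ℝ := fun p => 1 / ((p : ℝ) + 1) with he
  have he0 : ∀ p, 0 < e p := fun p => by simp only [he]; positivity
  have he1 : ∀ p, e p ≤ 1 := fun p => by
    simp only [he]
    rw [div_le_one (by positivity)]
    linarith [(Nat.cast_nonneg p : (0 : ℝ) ≤ p)]
  set f : ℕ → ℂ → ℝ := fun p =>
    (Metric.closedBall (0 : ℂ) 1).indicator (fun z => (‖z‖ ^ 2 + e p)⁻¹) with hf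
  set F : ℂ → ℝ := fun z => (Set.Icc (0 : ℝ) 1).indicator (fun r => (r ^ 2)⁻¹) ‖z‖ with hF
  have hfi : ∀ p, Integrable (f p) := fun p =>
    integrable_indicator_closedBall (continuous_inv_norm_sq_add (he0 p))
  have hf0 : ∀ p z, 0 ≤ f p z := fun p z =>
    Set.indicator_nonneg (fun z _ => by have := he0 p; positivity) z
  have hF0 : ∀ z, 0 ≤ F z := fun z => Set.indicator_nonneg (fun r _ => by positivity) _
  have hFm : Measurable F := by
    have : Measurable fun r : ℝ => (r ^ 2)⁻¹ := by fun_prop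
    exact (this.indicator measurableSet_Icc).comp measurable_norm
  have hfm : ∀ p, Measurable (f p) := fun p =>
    (continuous_inv_norm_sq_add (he0 p)).measurable.indicator
      Metric.isClosed_closedBall.measurableSet
  have hlim : ∀ᵐ z : ℂ, ENNReal.ofReal (F z) =
      Filter.liminf (fun p => ENNReal.ofReal (f p z)) Filter.atTop := by
    have h0 : ∀ᵐ z : ℂ, z ≠ 0 := compl_mem_ae_iff.2 (measure_singleton 0)
    filter_upwards [h0] with z hz
    refine (Filter.Tendsto.liminf_eq ?_).symm
    refine (ENNReal.continuous_ofReal.tendsto _).comp ?_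
    by_cases hz1 : ‖z‖ ≤ 1
    · have e1 : F z = (‖z‖ ^ 2 + 0)⁻¹ := by
        simp [hF, Set.indicator_of_mem, hz1]
      have e2 : ∀ p, f p z = (‖z‖ ^ 2 + e p)⁻¹ := fun p =>
        Set.indicator_of_mem (by simpa using hz1) _
      simp only [e1, e2]
      refine (tendsto_const_nhds.add tendsto_one_div_add_atTop_nhds_zero_nat).inv₀ ?_
      have := norm_pos_iff.2 hz
      positivity
    · have e1 : F z = 0 := by
        simp [hF, hz1]
      have e2 : ∀ p, f p z = 0 := fun p =>
        Set.indicator_of_notMem (by simpa using hz1) _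
      simp only [e1, e2]
      exact tendsto_const_nhds
  refine ⟨hFm.aestronglyMeasurable, ?_⟩
  rw [hasFiniteIntegral_iff_ofReal (Filter.Eventually.of_forall hF0), lintegral_congr_ae hlim]
  refine (lintegral_liminf_le fun p => (hfm p).ennreal_ofReal).trans_lt ?_
  refine lt_of_le_of_lt ?_ (ENNReal.ofReal_lt_top (r := C))
  refine Filter.liminf_le_of_le (by isBoundedDefault) fun b hb => ?_
  obtain ⟨p, hp⟩ := hb.exists
  refine hp.trans ?_
  rw [← ofReal_integral_eq_lintegral_ofReal (hfi p) (Filter.Eventually.of_forall (hf0 p))]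
  exact ENNReal.ofReal_le_ofReal (h (e p) (he0 p) (he1 p))

variable {ι : Type} [Fintype ι] [DecidableEq ι]

omit [DecidableEq ι] in
theorem barrierFactor_le [Nonempty ι] {ε : ℝ} (hε : 0 < ε) (hε1 : ε ≤ 1) {z : ι → ℂ}
    (hz : z ≠ 0) (j : ι) : barrierFactor ε z j ≤ 2 * Fintype.card ι := by
  have hN : (0 : ℝ) < Fintype.card ι := by exact_mod_cast Fintype.card_pos
  have h1 : ‖z j‖ ^ 2 / ∑ l, ‖z l‖ ^ 2 ≤ 1 := by
    rw [div_le_one (sum_norm_sq_pos hz)]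
    exact Finset.single_le_sum (f := fun l => ‖z l‖ ^ 2) (fun _ _ => by positivity)
      (Finset.mem_univ j)
  unfold barrierFactor
  rw [div_le_iff₀ (by positivity)]
  have : 2 * (Fintype.card ι : ℝ) * (1 / Fintype.card ι + ε) = 2 + 2 * Fintype.card ι * ε := by
    field_simp
  rw [this]
  have : 0 < 2 * (Fintype.card ι : ℝ) * ε := by positivity
  linarith

theorem barrierFactor_affVec_le [Nonempty ι] {ε : ℝ} (hε : 0 < ε) (i : ι) (w : AffIdx i → ℂ)
    (l : AffIdx i) :
    barrierFactor ε (affVec i w) l ≤ Fintype.card ι * (‖w l‖ ^ 2 + ε) := by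
  have hN : (0 : ℝ) < Fintype.card ι := by exact_mod_cast Fintype.card_pos
  have hS : 1 ≤ diagQuad 1 (fun _ : AffIdx i => 1) w := by
    have : 0 ≤ ∑ j, (1 : ℝ) * ‖w j‖ ^ 2 := Finset.sum_nonneg fun j _ => by positivity
    rw [diagQuad]; linarith
  have e : affVec i w l = w l := by simp [affVec, l.2]
  unfold barrierFactor
  rw [sum_norm_affVec_sq, e, div_le_iff₀ (by positivity)]
  have h1 : ‖w l‖ ^ 2 / diagQuad 1 (fun _ => 1) w ≤ ‖w l‖ ^ 2 := div_le_self (by positivity) hS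
  have h2 : (Fintype.card ι : ℝ) * (‖w l‖ ^ 2 + ε) * (1 / Fintype.card ι + ε) =
      (‖w l‖ ^ 2 + ε) + Fintype.card ι * (‖w l‖ ^ 2 + ε) * ε := by
    field_simp
  have h3 : 0 ≤ (Fintype.card ι : ℝ) * (‖w l‖ ^ 2 + ε) * ε := by positivity
  rw [h2]
  linarith

/-- All factors are at most `2N`, and the `l`-th one is at most `2N (|w_l|² + ε)`; only this factor
is kept. -/
theorem exp_neg_mul_barrier_ge [Nonempty ι] {α : ℝ} (hα : 1 ≤ α) {ε : ℝ} (hε : 0 < ε)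
    (hε1 : ε ≤ 1) (i : ι) (w : AffIdx i → ℂ) (l : AffIdx i) :
    Real.exp (-α * Fintype.card ι * Real.log (2 * Fintype.card ι)) * (‖w l‖ ^ 2 + ε)⁻¹ ≤
      Real.exp (-α * barrier ε (affPoint i w)) := by
  have hN : (0 : ℝ) < Fintype.card ι := by exact_mod_cast Fintype.card_pos
  have hw : 0 < ‖w l‖ ^ 2 + ε := by positivity
  rw [affPoint, barrier_mk]
  set y := barrierFactor ε (affVec i w) with hy
  have hy0 : ∀ j, 0 < y j := barrierFactor_pos hε _
  have h1 : ∀ j, Real.log (y j) ≤ Real.log (2 * Fintype.card ι) := fun j =>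
    Real.log_le_log (hy0 j) (barrierFactor_le hε hε1 (affVec_ne_zero i w) j)
  have h2 : Real.log (y l) ≤ Real.log (2 * Fintype.card ι) + Real.log (‖w l‖ ^ 2 + ε) := by
    rw [← Real.log_mul (by positivity) hw.ne']
    refine Real.log_le_log (hy0 l) ((barrierFactor_affVec_le hε i w l).trans ?_)
    have : 0 < (Fintype.card ι : ℝ) * (‖w l‖ ^ 2 + ε) := by positivity
    linarith
  have h3 : Real.log (2 * Fintype.card ι) - Real.log (y l) ≤
      ∑ j, (Real.log (2 * Fintype.card ι) - Real.log (y j)) :=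
    Finset.single_le_sum (f := fun j => Real.log (2 * Fintype.card ι) - Real.log (y j))
      (fun j _ => sub_nonneg.2 (h1 j)) (Finset.mem_univ (l : ι))
  rw [Finset.sum_sub_distrib] at h3
  simp only [Finset.sum_const, Finset.card_univ, nsmul_eq_mul] at h3
  nth_rw 1 [← Real.exp_log hw]
  rw [← Real.exp_neg, ← Real.exp_add, Real.exp_le_exp]
  -- The gap between `N log (2N)` and the barrier is nonnegative, so multiplying it by `α ≥ 1` can
  -- only enlarge it.
  have h4 := sub_nonneg.2 (h1 l)
  nlinarith

theorem volDensity_ge {a : ℝ} (ha : 0 ≤ a) (i : ι) {w : AffIdx i → ℂ} (hw : ∀ j, ‖w j‖ ≤ 1) :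
    (2 * a) ^ Fintype.card (AffIdx i) /
      (1 + Fintype.card (AffIdx i) : ℝ) ^ (Fintype.card (AffIdx i) + 1) ≤ volDensity a i w := by
  have hS : 0 < diagQuad 1 (fun _ : AffIdx i => 1) w :=
    diagQuad_pos one_pos (fun _ => zero_le_one) w
  unfold volDensity
  gcongr
  rw [diagQuad]
  gcongr
  calc ∑ j, 1 * ‖w j‖ ^ 2 ≤ ∑ _j : AffIdx i, (1 : ℝ) := Finset.sum_le_sum fun j _ => by
        rw [one_mul]
        exact pow_le_one₀ (norm_nonneg _) (hw j)
    _ = _ := by simp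

/-- The exponential integrals of the barriers are not bounded for exponents at least `1`. -/
theorem not_bounded_integral_exp_barrier [Nonempty ι] (i : ι) (l : AffIdx i) {α : ℝ}
    (hα : 1 ≤ α) (C : ℝ) :
    ¬ ∀ ε : ℝ, 0 < ε → ε ≤ 1 →
      Integrable (fun x => Real.exp (-α * barrier ε x)) (volumeElement (Fintype.card ι) i) ∧
        ∫ x, Real.exp (-α * barrier ε x) ∂(volumeElement (Fintype.card ι) i) ≤ C := by
  intro h
  obtain ⟨N, hN⟩ : ∃ N : ℝ, N = Fintype.card ι := ⟨_, rfl⟩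
  have hN0 : 0 < N := by rw [hN]; exact_mod_cast Fintype.card_pos
  simp only [← hN] at h
  -- The minimum of the volume density estimate on the unit polydisc, times the constant of
  -- `exp_neg_mul_barrier_ge`.
  set κ : ℝ := (2 * N) ^ Fintype.card (AffIdx i) /
    (1 + Fintype.card (AffIdx i) : ℝ) ^ (Fintype.card (AffIdx i) + 1) *
    Real.exp (-α * N * Real.log (2 * N)) with hκ
  have hκ0 : 0 < κ := by positivity
  set B := Metric.closedBall (0 : ℂ) 1 with hB
  set V : ℝ := ∏ j ∈ Finset.univ.erase l, ∫ z : ℂ, B.indicator (fun _ => (1 : ℝ)) z with hV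
  have hV0 : 0 < V := by
    refine Finset.prod_pos fun j _ => ?_
    rw [integral_indicator_const _ Metric.isClosed_closedBall.measurableSet, smul_eq_mul, mul_one]
    exact ENNReal.toReal_pos (Metric.measure_closedBall_pos volume 0 one_pos).ne'
      measure_closedBall_lt_top.ne
  refine not_bounded_integral_inv_norm_sq_add (C / (κ * V)) fun ε hε hε1 => ?_
  obtain ⟨h1, h2⟩ := h ε hε hε1
  have hcont : Continuous fun x : ProjSpace ι => Real.exp (-α * barrier ε x) :=
    Real.continuous_exp.comp (continuous_const.mul (isSmooth_barrier hε).continuous)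
  rw [integrable_volumeElement hN0.le i hcont] at h1
  rw [integral_volumeElement hN0.le i hcont] at h2
  -- The minorant, supported on the polydisc, is a product of functions of one variable, so its
  -- integral factors: `V` from the other coordinates times the divergent integral in `w_l`.
  set g : AffIdx i → ℂ → ℝ := fun j =>
    B.indicator (if j = l then fun z => (‖z‖ ^ 2 + ε)⁻¹ else fun _ => 1) with hg
  have hgi : ∀ j, Integrable (g j) := by
    intro j
    refine integrable_indicator_closedBall ?_
    by_cases hj : j = l
    · simpa [hj] using continuous_inv_norm_sq_add hε
    · simpa [hj] using continuous_const
  have hG : Integrable fun w : AffIdx i → ℂ => κ * ∏ j, g j (w j) :=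
    (Integrable.fintype_prod (μ := fun _ => volume) hgi).const_mul _
  have hle : ∀ w : AffIdx i → ℂ, κ * ∏ j, g j (w j) ≤
      volDensity N i w * Real.exp (-α * barrier ε (affPoint i w)) := by
    intro w
    by_cases hw : ∀ j, ‖w j‖ ≤ 1
    · have e : ∏ j, g j (w j) = (‖w l‖ ^ 2 + ε)⁻¹ := by
        rw [Finset.prod_eq_single l]
        · simp [hg, hB, hw l]
        · intro j _ hj
          simp [hg, hB, hw j, hj]
        · simp
      rw [e, hκ, mul_assoc]
      refine mul_le_mul (volDensity_ge hN0.le i hw) ?_ (by positivity) (volDensity_nonneg hN0.le i w)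
      rw [hN]
      exact exp_neg_mul_barrier_ge hα hε hε1 i w l
    · push Not at hw
      obtain ⟨j, hj⟩ := hw
      have e : ∏ j, g j (w j) = 0 := by
        refine Finset.prod_eq_zero (Finset.mem_univ j) (Set.indicator_of_notMem ?_ _)
        simpa [hB] using hj
      rw [e, mul_zero]
      exact mul_nonneg (volDensity_nonneg hN0.le i w) (Real.exp_pos _).le
  have h3 := (integral_mono hG h1 hle).trans h2
  have h4 : ∫ w : AffIdx i → ℂ, ∏ j, g j (w j) = ∏ j, ∫ z, g j z :=
    integral_fintype_prod_volume_eq_prod g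
  have h5 : ∏ j, ∫ z, g j z = (∫ z, B.indicator (fun z => (‖z‖ ^ 2 + ε)⁻¹) z) * V := by
    rw [← Finset.mul_prod_erase _ _ (Finset.mem_univ l)]
    congr 1
    · simp [hg]
    · refine Finset.prod_congr rfl fun j hj => ?_
      simp [hg, Finset.ne_of_mem_erase hj]
  rw [integral_const_mul, h4, h5] at h3
  rw [le_div_iff₀ (by positivity)]
  linarith

theorem not_hasUniformBound_of_one_le {n k : ℕ} [NeZero n] [NeZero k] (h : 2 ≤ k * n) {α : ℝ}
    (hα : 1 ≤ α) : ¬ HasUniformBound n k α := by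
  rintro ⟨C, hC⟩
  -- A second coordinate provides the hyperplane `z_l = 0` on which the barriers degenerate; for `m
  -- = 0` the space is a point.
  have : Nontrivial (Idx n k) := Fintype.one_lt_card_iff_nontrivial.1 (by
    simpa using Nat.lt_of_succ_le h)
  obtain ⟨l, hl⟩ := exists_ne ((0, 0) : Idx n k)
  refine not_bounded_integral_exp_barrier ((0, 0) : Idx n k) ⟨l, hl⟩ hα C fun ε hε _ => ?_
  rw [card_Idx]
  exact hC _ (isNormalized_barrier hε)

theorem tianInvariant_eq_one {n k : ℕ} [NeZero n] [NeZero k] (h : 2 ≤ k * n) :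
    tianInvariant n k = 1 := by
  refine le_antisymm (sSup_le ?_) (le_of_forall_lt fun c hc => ?_)
  · rintro _ ⟨α, ⟨_, hα⟩, rfl⟩
    have : α < 1 := lt_of_not_ge fun h1 => not_hasUniformBound_of_one_le h h1 hα
    exact EReal.coe_le_coe_iff.2 this.le
  · obtain ⟨x, hcx, hx1⟩ := EReal.lt_iff_exists_real_btwn.1 hc
    have hx : x < 1 := by exact_mod_cast hx1
    -- Only positive exponents enter the supremum, while `x` may be negative; hence the maximum with
    -- `1/2`.
    refine lt_of_lt_of_le (hcx.trans_le ?_) (le_sSup ⟨max x (1 / 2), ⟨?_, ?_⟩, rfl⟩)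
    · exact EReal.coe_le_coe_iff.2 (le_max_left x (1 / 2))
    · exact lt_max_of_lt_right (by norm_num)
    · exact hasUniformBound_of_lt_one (max_lt hx (by norm_num))

end Divergence

end ProjKahler

end

theorem mainTheorem2 (n k : ℕ) [NeZero n] [NeZero k] :
    (∀ α : ℝ, α < 1 →
      ∃ C : ℝ, ∀ φ : ProjKahler.ProjSpace (ProjKahler.Idx n k) → ℝ,
        ProjKahler.IsNormalized φ →
          MeasureTheory.Integrable (fun x => Real.exp (-α * φ x)) (ProjKahler.dv n k) ∧
            ∫ x, Real.exp (-α * φ x) ∂(ProjKahler.dv n k) ≤ C) ∧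
    (2 ≤ k * n →
      (∀ α : ℝ, 1 ≤ α → ¬ ProjKahler.HasUniformBound n k α) ∧
      ProjKahler.tianInvariant n k = 1) :=
  ⟨fun _ hα => ProjKahler.hasUniformBound_of_lt_one hα, fun h =>
    ⟨fun _ hα => ProjKahler.not_hasUniformBound_of_one_le h hα,
      ProjKahler.tianInvariant_eq_one h⟩⟩
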